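/- **Conventions.** A *metric scalable group* is a triple $(G,\delta,d)$ where $G$ is a topological group, $d$ is a left-invariant distance inducing its topology, and $\delta:\mathbb R\times G\to G$ is continuous, such that $\delta_\lambda=\delta(\lambda,\cdot)$ is an automorphism of $G$ for $\lambda\neq0$, $\delta_\lambda\circ\delta_\mu=\delta_{\lambda\mu}$ for all $\lambda,\mu\in\mathbb R$, $\delta_0\equiv e$, and $d(\delta_t p,\delta_t q)=|t|\,d(p,q)$ for all $t\in\mathbb R$, $p,q\in G$. A *Banach Lie group* of class $C^k$ ($k\in\{1,2,\dots,\infty,\omega\}$) is a topological group carrying a $C^k$-manifold structure, modelled on a real Banach space and compatible with its topology, for which multiplication and inversion are $C^k$. A *Banach homogeneous group* is a topological group with dilations $(G,\delta)$, $\delta:\mathbb R\times G\to G$, that is isomorphic (by a homeomorphic group isomorphism intertwining the dilations) to a real Banach space $\mathfrak g$ with its norm topology, where $\mathfrak g=V_1\oplus\dots\oplus V_s$ with closed subspaces $V_i$, $\mathfrak g$ has a continuous Lie bracket with $[V_i,V_j]\subseteq V_{i+j}$ ($V_i=0$ for $i>s$), the group product is given by the Baker–Campbell–Hausdorff formula,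 and $\delta_t$ is multiplication by $t^i$ on $V_i$. Let $\mathbb H^1=\mathbb R^3$ be the first Heisenberg group, $(x,y,z)(x',y',z')=(x+x',\,y+y',\,z+z'+\tfrac12(xy'-yx'))$, with dilations $\delta_t(x,y,z)=(tx,ty,t^2z)$ and with any homogeneous distance $d$, i.e. any left-invariant distance inducing the Euclidean topology with $d(\delta_tp,\delta_tq)=|t|\,d(p,q)$ for all $t\in\mathbb R$. Let $$\ell_1(\mathbb H^1)=\Big\{(p_n)_{n\in\mathbb N}:\ p_n\in\mathbb H^1,\ \sum_n d(p_n,e)<\infty\Big\}$$ with the componentwise product and the distance $\sum_n d(p_n,q_n)$. Let $\ell_{1/2}(\mathbb R)=\{(a_n)_{n\in\mathbb N}:\sum_n\sqrt{|a_n|}<\infty\}$ with the distance $\sum_n\sqrt{|a_n-b_n|}$. **Proposition.** 1. With the componentwise dilations, $\ell_1(\mathbb H^1)$ is a metric scalable group (in particular a topological group). 2. The topological group $\ell_1(\mathbb H^1)$ is not a Banach Lie group, of any class $C^k$ with $k\in\{1,2,\dots,\infty,\omega\}$. 3. The center of $\ell_1(\mathbb H^1)$ consists of the sequences in $\ell_1(\mathbb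 H^1)$ all of whose entries lie in the center of $\mathbb H^1$. The map $(a_n)_n\mapsto((0,0,a_n))_n$ is an isomorphism of topological groups from $\ell_{1/2}(\mathbb R)$ onto this center, and it multiplies distances by a constant $c>0$. 4. $\ell_{1/2}(\mathbb R)$ is a topological vector space that is not locally convex. 5. Metric scalable groups strictly extend Banach homogeneous groups: every Banach homogeneous group $(G,\delta)$ admits a distance $d$, inducing its topology, for which $(G,\delta,d)$ is a metric scalable group, whereas $\ell_1(\mathbb H^1)$ is not a Banach homogeneous group for any choice of dilations. -/

import Mathlib

open scoped Manifold ContDiff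

universe u v w

/-! ### Scalable groups and metric scalable groups -/

/-- A scalable group: a topological group `G` with a continuous map `δ : ℝ × G → G` such that
`δ_t` is an automorphism of `G` for `t ≠ 0`, `δ_s ∘ δ_t = δ_{st}`, and `δ_0` is constantly `1`.
(Continuity of `δ_t` and of its inverse follows from the joint continuity.) -/
structure IsScalableGroup (G : Type u) [Group G] [TopologicalSpace G] (δ : ℝ → G → G) :
    Prop where
  isTopologicalGroup : IsTopologicalGroup G
  continuous_dil : Continuous fun q : ℝ × G => δ q.1 q.2
  map_mul : ∀ t : ℝ, t ≠ 0 → ∀ p q : G, δ t (p * q) = δ t p * δ t q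
  bijective : ∀ t : ℝ, t ≠ 0 → Function.Bijective (δ t)
  comp : ∀ (s t : ℝ) (p : G), δ s (δ t p) = δ (s * t) p
  zero : ∀ p : G, δ 0 p = 1

/-- A metric scalable group: a scalable group whose topology is that of a left-invariant distance
for which every `δ_t` scales distances by the factor `|t|`. -/
structure IsMetricScalableGroup (G : Type u) [Group G] [MetricSpace G] (δ : ℝ → G → G) :
    Prop extends IsScalableGroup G δ where
  dist_mul_left : ∀ g p q : G, dist (g * p) (g * q) = dist p q
  dist_dil : ∀ (t : ℝ) (p q : G), dist (δ t p) (δ t q) = |t| * dist p q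

/-! ### The first Heisenberg group -/

/-- The first Heisenberg group, in exponential coordinates. -/
@[ext]
structure Heisenberg where
  x : ℝ
  y : ℝ
  z : ℝ

namespace Heisenberg

noncomputable instance : Group Heisenberg where
  mul p q := ⟨p.x + q.x, p.y + q.y, p.z + q.z + (p.x * q.y - p.y * q.x) / 2⟩
  one := ⟨0, 0, 0⟩
  inv p := ⟨-p.x, -p.y, -p.z⟩
  mul_assoc p q r := by
    change (⟨_, _, _⟩ : Heisenberg) = ⟨_, _, _⟩
    congr 1
    · exact add_assoc _ _ _
    · exact add_assoc _ _ _
    · change p.z + q.z + (p.x * q.y - p.y * q.x) / 2 + r.z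
          + ((p.x + q.x) * r.y - (p.y + q.y) * r.x) / 2
        = p.z + (q.z + r.z + (q.x * r.y - q.y * r.x) / 2)
          + (p.x * (q.y + r.y) - p.y * (q.x + r.x)) / 2
      ring
  one_mul p := by
    change (⟨0 + p.x, 0 + p.y, 0 + p.z + (0 * p.y - 0 * p.x) / 2⟩ : Heisenberg) = p
    ext <;> simp
  mul_one p := by
    change (⟨p.x + 0, p.y + 0, p.z + 0 + (p.x * 0 - p.y * 0) / 2⟩ : Heisenberg) = p
    ext <;> simp
  inv_mul_cancel p := by
    change (⟨-p.x + p.x, -p.y + p.y, -p.z + p.z + (-p.x * p.y - -p.y * p.x) / 2⟩ : Heisenberg)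
      = ⟨0, 0, 0⟩
    ext <;> simp
    ring

/-- The Carnot group dilations `(x, y, z) ↦ (tx, ty, t²z)`. -/
def dil (t : ℝ) (p : Heisenberg) : Heisenberg := ⟨t * p.x, t * p.y, t ^ 2 * p.z⟩

/-- The global coordinates on the Heisenberg group; its Lie group topology is the one that makes
them a homeomorphism. -/
def coords (p : Heisenberg) : ℝ × ℝ × ℝ := (p.x, p.y, p.z)

end Heisenberg

/-! ### The `ℓ₁`-sum of countably many copies of a group with a left-invariant distance -/

section Ell1

variable (G : Type u) [Group G] [MetricSpace G] [IsIsometricSMul G G]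

/-- The sequences `x` in `G` with `∑ d(xₙ, 1) < ∞`, a subgroup for the componentwise product. -/
def ell1Subgroup : Subgroup (ℕ → G) where
  carrier := {x | Summable fun n => dist (x n) 1}
  one_mem' := by simp [summable_zero]
  mul_mem' {a b} ha hb := by
    refine Summable.of_nonneg_of_le (fun _ => dist_nonneg) (fun n => ?_) (hb.add ha)
    calc dist (a n * b n) 1 ≤ dist (a n * b n) (a n * 1) + dist (a n * 1) 1 :=
          dist_triangle _ _ _
      _ = dist (b n) 1 + dist (a n) 1 := by rw [dist_mul_left, mul_one]
  inv_mem' {a} ha := by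
    refine (summable_congr fun n => ?_).mpr ha
    change dist (a n)⁻¹ 1 = dist (a n) 1
    rw [← dist_mul_left (a n), mul_inv_cancel, mul_one, dist_comm]

/-- The group `ℓ₁(G)`. It is not given the topology of a subspace of the product, but that of
its `ℓ₁` distance, below. -/
def Ell1 : Type u := ↥(ell1Subgroup G)

namespace Ell1

instance : Group (Ell1 G) := inferInstanceAs (Group (ell1Subgroup G))

instance : CoeFun (Ell1 G) fun _ => ℕ → G := ⟨fun x => x.1⟩

variable {G}

theorem summable_dist (x y : Ell1 G) : Summable fun n => dist (x n) (y n) :=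
  Summable.of_nonneg_of_le (fun _ => dist_nonneg)
    (fun n => dist_triangle_right (x n) (y n) 1) (Summable.add x.2 y.2)

/-- The distance `d(x, y) = ∑ d(xₙ, yₙ)`. -/
noncomputable instance : MetricSpace (Ell1 G) where
  dist x y := ∑' n, dist (x n) (y n)
  dist_self x := by simp
  dist_comm x y := by simp only [dist_comm]
  dist_triangle x y z := by
    rw [← (summable_dist x y).tsum_add (summable_dist y z)]
    exact (summable_dist x z).tsum_le_tsum (fun n => dist_triangle _ _ _)
      ((summable_dist x y).add (summable_dist y z))
  eq_of_dist_eq_zero {x y} h := by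
    have h0 := (hasSum_zero_iff_of_nonneg fun n => dist_nonneg).mp
      (h ▸ (summable_dist x y).hasSum)
    exact Subtype.ext (funext fun n => dist_eq_zero.mp (congrFun h0 n))

end Ell1

end Ell1

/-! ### The space `ℓ_{1/2}(ℝ)` -/

theorem sqrt_add_le_sqrt_add_sqrt (a b : ℝ) : √(a + b) ≤ √a + √b := by
  rcases le_total a 0 with ha | ha
  · rw [Real.sqrt_eq_zero_of_nonpos ha, zero_add]
    exact Real.sqrt_le_sqrt (by linarith)
  rcases le_total b 0 with hb | hb
  · rw [Real.sqrt_eq_zero_of_nonpos hb, add_zero]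
    exact Real.sqrt_le_sqrt (by linarith)
  refine Real.sqrt_le_iff.mpr ⟨by positivity, ?_⟩
  nlinarith [Real.sq_sqrt ha, Real.sq_sqrt hb, mul_nonneg (Real.sqrt_nonneg a) (Real.sqrt_nonneg b)]

/-- The real sequences `a` with `∑ √|aₙ| < ∞`. -/
noncomputable def ellHalfSubmodule : Submodule ℝ (ℕ → ℝ) where
  carrier := {a | Summable fun n => √|a n|}
  zero_mem' := by simp [summable_zero]
  add_mem' {a b} ha hb := by
    refine Summable.of_nonneg_of_le (fun _ => Real.sqrt_nonneg _) (fun n => ?_) (ha.add hb)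
    exact (Real.sqrt_le_sqrt (abs_add_le _ _)).trans (sqrt_add_le_sqrt_add_sqrt _ _)
  smul_mem' c a ha := by
    refine (summable_congr fun n => ?_).mpr (Summable.mul_left √|c| ha)
    simp [abs_mul]

/-- The vector space `ℓ_{1/2}(ℝ)`, with the topology of the distance below. -/
def EllHalf : Type := ↥ellHalfSubmodule

namespace EllHalf

noncomputable instance : AddCommGroup EllHalf :=
  inferInstanceAs (AddCommGroup ellHalfSubmodule)

noncomputable instance : Module ℝ EllHalf := inferInstanceAs (Module ℝ ellHalfSubmodule)

instance : CoeFun EllHalf fun _ => ℕ → ℝ := ⟨fun a => a.1⟩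

theorem summable_sqrt (a b : EllHalf) : Summable fun n => √|a n - b n| := (a - b).2

/-- The distance `d(a, b) = ∑ √|aₙ - bₙ|`. -/
noncomputable instance : MetricSpace EllHalf where
  dist a b := ∑' n, √|a n - b n|
  dist_self a := by simp
  dist_comm a b := by simp only [abs_sub_comm]
  dist_triangle a b c := by
    rw [← (summable_sqrt a b).tsum_add (summable_sqrt b c)]
    exact (summable_sqrt a c).tsum_le_tsum (fun n =>
      (Real.sqrt_le_sqrt (abs_sub_le _ _ _)).trans (sqrt_add_le_sqrt_add_sqrt _ _))
      ((summable_sqrt a b).add (summable_sqrt b c))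
  eq_of_dist_eq_zero {a b} h := by
    have h0 := (hasSum_zero_iff_of_nonneg fun n => Real.sqrt_nonneg _).mp
      (h ▸ (summable_sqrt a b).hasSum)
    refine Subtype.ext (funext fun n => ?_)
    have h1 : √|a n - b n| = 0 := congrFun h0 n
    exact sub_eq_zero.mp (abs_eq_zero.mp ((Real.sqrt_eq_zero (abs_nonneg _)).mp h1))

end EllHalf

/-! ### Banach Lie groups -/

/-- The topological group `G` is a Banach Lie group of class `C^k`: it carries the structure of a
`C^k` manifold modelled on a real Banach space, compatible with its topology, for which
multiplication and inversion are of class `C^k`. -/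
def IsBanachLieGroup (k : WithTop ℕ∞) (G : Type u) [Group G] [TopologicalSpace G] : Prop :=
  ∃ (E : Type v) (_ : NormedAddCommGroup E) (_ : NormedSpace ℝ E) (_ : CompleteSpace E)
    (_ : ChartedSpace E G), LieGroup 𝓘(ℝ, E) k G

/-! ### Banach homogeneous groups -/

/-- A graded Banach Lie algebra structure on the Banach space `E`: a continuous Lie bracket and
a decomposition `E = V₁ ⊕ ⋯ ⊕ V_s` into closed subspaces with `[V_i, V_j] ⊆ V_{i+j}`, where
`V_i = 0` for `i > s`. The decomposition is given by its continuous projections `π i`, whose ranges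
are the `V_i`. -/
structure GradedBanachLieAlgebra (E : Type v) [NormedAddCommGroup E] [NormedSpace ℝ E] where
  bracket : E →L[ℝ] E →L[ℝ] E
  bracket_self : ∀ x, bracket x x = 0
  jacobi : ∀ x y z,
    bracket x (bracket y z) + bracket y (bracket z x) + bracket z (bracket x y) = 0
  step : ℕ
  π : ℕ → E →L[ℝ] E
  π_π_same : ∀ i x, π i (π i x) = π i x
  π_π_of_ne : ∀ i j x, i ≠ j → π i (π j x) = 0
  π_eq_zero : ∀ i, i ∉ Finset.Icc 1 step → π i = 0
  sum_π : ∀ x, ∑ i ∈ Finset.Icc 1 step, π i x = x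
  π_bracket : ∀ i j x y, π (i + j) (bracket (π i x) (π j y)) = bracket (π i x) (π j y)

namespace GradedBanachLieAlgebra

variable {E : Type v} [NormedAddCommGroup E] [NormedSpace ℝ E] (L : GradedBanachLieAlgebra E)

/-- The iterated bracket `[a₁, [a₂, … [a_{m-1}, a_m]…]]`. -/
noncomputable def nested : List E → E
  | [] => 0
  | [a] => a
  | a :: b :: l => L.bracket a (nested (b :: l))

open scoped Nat in
/-- The Baker-Campbell-Hausdorff product, by Dynkin's formula
`∑_{n ≥ 1} (-1)^{n-1}/n ∑_{r_i + s_i > 0}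
  [x^{r_1} y^{s_1} ⋯ x^{r_n} y^{s_n}] / ((∑ (r_i + s_i)) ∏ r_i! s_i!)`.
The iterated brackets of more than `step` elements vanish, so the sum is cut off to a finite one
that has all the nonzero terms. -/
noncomputable def bch (x y : E) : E :=
  ∑ n ∈ Finset.Icc 1 L.step,
    ∑ f ∈ Fintype.piFinset fun _ : Fin n =>
        (Finset.range (L.step + 1) ×ˢ Finset.range (L.step + 1)).filter fun q => 0 < q.1 + q.2,
      ((-1 : ℝ) ^ (n - 1) /
          (n * (∑ i, (((f i).1 : ℝ) + (f i).2)) * ∏ i, (((f i).1 ! : ℝ) * (f i).2 !))) •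
        L.nested ((List.ofFn f).flatMap fun q => List.replicate q.1 x ++ List.replicate q.2 y)

/-- The dilations: multiplication by `t^i` on `V_i`. -/
noncomputable def dil (t : ℝ) (x : E) : E := ∑ i ∈ Finset.Icc 1 L.step, t ^ i • L.π i x

end GradedBanachLieAlgebra

/-- The topological group `G` with dilations `δ` is a Banach homogeneous group: up to an
isomorphism, it is a graded Banach Lie algebra with the Baker-Campbell-Hausdorff product, the norm
topology, and the dilations of the grading. -/
def IsBanachHomogeneousGroup (G : Type u) [Group G] [TopologicalSpace G] (δ : ℝ → G → G) : Prop :=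
  ∃ (E : Type v) (_ : NormedAddCommGroup E) (_ : NormedSpace ℝ E) (_ : CompleteSpace E)
    (L : GradedBanachLieAlgebra E) (φ : E ≃ₜ G),
    (∀ x y, φ (L.bch x y) = φ x * φ y) ∧ ∀ t x, φ (L.dil t x) = δ t (φ x)

/-! The obstruction to a Lie group structure lies in the center, which is `ℓ_{1/2}(ℝ)` because a
homogeneous distance satisfies `d((0,0,a), e) = c√|a|`. If multiplication is strictly differentiable
in a chart at `1`, then `N` elements whose first `N` powers are all small have a small product
(`exists_nhds_one_prod_mem`): the `N`-th power is small, so each element has size `O(1/N)` in the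
chart, and `N` such elements multiply to something small. In `ℓ_{1/2}(ℝ)` this fails: for `N = M²`
multiples of distinct unit vectors, the powers up to the `N`-th grow only by a factor `√N = M`,
while the product of all of them grows by `N = M²`. One lemma,
`Ell1.not_hasStrictFDerivAt_chart_mul`, therefore excludes both Banach Lie groups and Banach
homogeneous groups, since Baker-Campbell-Hausdorff coordinates are a global `C¹` chart. The average
of the same vectors shows that `ℓ_{1/2}(ℝ)` is not locally convex.

For the group topology of `ℓ₁(ℍ¹)`, the distance is left-invariant, so only right translations
matter. In `ℍ¹`, right translation by `q` distorts `d(p, p')` by at most `K √d(p, p') √d(q, e)`, and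
Cauchy-Schwarz sums this over the entries.

For a graded Banach Lie algebra, the distance comes from the homogeneous norm `max (‖π i x‖ /
ε)^(1/i)`. The Baker-Campbell-Hausdorff product is the sum plus a remainder that is `O(‖x‖ ‖y‖)` on
the unit ball and has no component in `V₁`; for small `ε` this makes the norm subadditive
(`exists_gauge_bch_le`). -/

/-! ### Products of small elements in a group with a differentiable chart -/

section Chart

open Filter Topology

variable {G : Type u} [Group G] [TopologicalSpace G]
  {E : Type v} [NormedAddCommGroup E] [NormedSpace ℝ E]

/-- In a chart around `1` in which the multiplication is strictly differentiable, the product is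
close to the sum. -/
theorem eventually_norm_chart_mul_sub_le [ContinuousMul G] (e : OpenPartialHomeomorph G E)
    (h1 : (1 : G) ∈ e.source) {A : E × E →L[ℝ] E}
    (hA : HasStrictFDerivAt (fun v : E × E => e (e.symm v.1 * e.symm v.2)) A (e 1, e 1)) :
    ∀ᶠ q : G × G in 𝓝 1 ×ˢ 𝓝 1, q.1 * q.2 ∈ e.source ∧
      ‖(e (q.1 * q.2) - e 1) - (e q.2 - e 1) - (e q.1 - e 1)‖ ≤ 1 / 2 * ‖e q.1 - e 1‖ := by
  have htar : e.target ∈ 𝓝 (e 1) := e.open_target.mem_nhds (e.map_source h1)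
  -- Right multiplication by `1` is the identity near `e 1`, so `A` is the identity on the first
  -- factor.
  have hAinl : ∀ h : E, A (h, 0) = h := by
    have hd : HasFDerivAt (fun x : E => e (e.symm x * e.symm (e 1)))
        (A.comp ((ContinuousLinearMap.id ℝ E).prod (0 : E →L[ℝ] E))) (e 1) := by
      have h2 : HasFDerivAt (fun x : E => (x, e 1))
          ((ContinuousLinearMap.id ℝ E).prod (0 : E →L[ℝ] E)) (e 1) :=
        (hasFDerivAt_id _).prodMk (hasFDerivAt_const _ _)
      exact HasFDerivAt.comp (f := fun x : E => (x, e 1))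
        (g := fun v : E × E => e (e.symm v.1 * e.symm v.2)) (e 1) hA.hasFDerivAt h2
    have hid : HasFDerivAt (fun x : E => e (e.symm x * e.symm (e 1)))
        (ContinuousLinearMap.id ℝ E) (e 1) := by
      refine (hasFDerivAt_id (e 1)).congr_of_eventuallyEq ?_
      filter_upwards [htar] with x hx
      simp [e.left_inv h1, e.right_inv hx]
    intro h
    simpa using DFunLike.congr_fun (hd.unique hid) h
  have hce : Tendsto e (𝓝 1) (𝓝 (e 1)) := e.continuousAt h1
  have hb := hA.isLittleO.def (show (0 : ℝ) < 1 / 2 by norm_num)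
  -- Strict differentiability is applied to the pairs `(e g, e h)` and `(e 1, e h)`. They differ
  -- only in the first slot, so the error is bounded by `‖e g - e 1‖` alone, whatever the size of
  -- `h`; this is what lets the errors add up over long products.
  have ht : Tendsto (fun q : G × G => ((e q.1, e q.2), (e 1, e q.2))) (𝓝 1 ×ˢ 𝓝 1)
      (𝓝 ((e 1, e 1), (e 1, e 1))) := by
    have ha : Tendsto (fun q : G × G => e q.1) (𝓝 1 ×ˢ 𝓝 1) (𝓝 (e 1)) := hce.comp tendsto_fst
    have hb : Tendsto (fun q : G × G => e q.2) (𝓝 1 ×ˢ 𝓝 1) (𝓝 (e 1)) := hce.comp tendsto_snd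
    exact (ha.prodMk_nhds hb).prodMk_nhds (tendsto_const_nhds.prodMk_nhds hb)
  have hs : ∀ᶠ g : G in 𝓝 1, g ∈ e.source := e.open_source.mem_nhds h1
  have hm : ∀ᶠ q : G × G in 𝓝 1 ×ˢ 𝓝 1, q.1 * q.2 ∈ e.source := by
    have : Tendsto (fun q : G × G => q.1 * q.2) (𝓝 1 ×ˢ 𝓝 1) (𝓝 1) := by
      have := (continuous_mul (M := G)).tendsto (1, 1)
      rwa [nhds_prod_eq, mul_one] at this
    exact this hs
  filter_upwards [ht.eventually hb, hm, tendsto_fst.eventually hs, tendsto_snd.eventually hs]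
    with q hq hqm hq1 hq2
  refine ⟨hqm, ?_⟩
  simp only [e.left_inv hq1, e.left_inv hq2, e.left_inv h1, one_mul, Prod.mk_sub_mk, sub_self,
    hAinl, Prod.norm_mk, norm_zero] at hq
  rw [max_eq_left (norm_nonneg _)] at hq
  rwa [sub_sub_sub_cancel_right]

/-- In a group with a chart around `1` in which the multiplication is strictly differentiable,
small elements whose first `N` powers are small have small `N`-fold products. -/
theorem exists_nhds_one_prod_mem [ContinuousMul G] (e : OpenPartialHomeomorph G E)
    (h1 : (1 : G) ∈ e.source) {A : E × E →L[ℝ] E}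
    (hA : HasStrictFDerivAt (fun v : E × E => e (e.symm v.1 * e.symm v.2)) A (e 1, e 1))
    {U : Set G} (hU : U ∈ 𝓝 1) :
    ∃ V ∈ 𝓝 (1 : G), ∀ (N : ℕ) (g P : ℕ → G), 0 < N →
      (∀ i < N, ∀ k ≤ N, g i ^ k ∈ V) → P 0 = 1 → (∀ i, P (i + 1) = g i * P i) → P N ∈ U := by
  obtain ⟨W, hW, hmul⟩ := (eventually_prod_self_iff (r := fun g h : G => g * h ∈ e.source ∧
    ‖(e (g * h) - e 1) - (e h - e 1) - (e g - e 1)‖ ≤ 1 / 2 * ‖e g - e 1‖)).mp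
    (eventually_norm_chart_mul_sub_le e h1 hA)
  have hUW : e.symm ⁻¹' (U ∩ W) ∈ 𝓝 (e 1) := by
    refine (e.continuousAt_symm (e.map_source h1)).preimage_mem_nhds ?_
    rw [e.left_inv h1]
    exact inter_mem hU hW
  obtain ⟨ρ, hρ, hball⟩ := Metric.mem_nhds_iff.mp hUW
  have hsmall : ∀ g ∈ e.source, ‖e g - e 1‖ < ρ → g ∈ U ∩ W := fun g hg h => by
    have : e.symm (e g) ∈ U ∩ W := hball (by rwa [Metric.mem_ball, dist_eq_norm])
    rwa [e.left_inv hg] at this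
  -- The bound `ρ / 4` on `g ^ N` gives `ρ / (2N)` for `g`, then `3ρ / 4 < ρ` for a product of `N`
  -- factors.
  refine ⟨e.source ∩ {g | ‖e g - e 1‖ < ρ / 4}, inter_mem (e.open_source.mem_nhds h1) ?_, ?_⟩
  · have : Tendsto (fun g => ‖e g - e 1‖) (𝓝 1) (𝓝 ‖e 1 - e 1‖) :=
      ((e.continuousAt h1).tendsto.sub_const _).norm
    rw [sub_self, norm_zero] at this
    exact this.eventually (gt_mem_nhds (by positivity))
  intro N g P hN hg hP0 hP
  have hNpos : (0 : ℝ) < N := by exact_mod_cast hN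
  have hWg : ∀ i < N, ∀ k ≤ N, g i ^ k ∈ W := fun i hi k hk =>
    (hsmall _ (hg i hi k hk).1 ((hg i hi k hk).2.trans (by linarith))).2
  -- In the chart, `g ^ k` is `k` times `g` up to `k / 2` times the size of `g`. Hence `g ^ N` has
  -- at least `N / 2` times the size of `g`.
  have hgN : ∀ i < N, ‖e (g i) - e 1‖ ≤ ρ / 2 / N := by
    intro i hi
    have hpow : ∀ k ≤ N, ‖(e (g i ^ k) - e 1) - (k : ℝ) • (e (g i) - e 1)‖
        ≤ k / 2 * ‖e (g i) - e 1‖ := by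
      intro k
      induction k with
      | zero => simp
      | succ k ih =>
        intro hk
        have h2 := (hmul (g i) (by simpa using hWg i hi 1 hN) _ (hWg i hi k (by omega))).2
        have h3 := ih (by omega)
        rw [pow_succ']
        have h4 : (e (g i * g i ^ k) - e 1) - ((k + 1 : ℕ) : ℝ) • (e (g i) - e 1)
            = ((e (g i * g i ^ k) - e 1) - (e (g i ^ k) - e 1) - (e (g i) - e 1))
              + ((e (g i ^ k) - e 1) - (k : ℝ) • (e (g i) - e 1)) := by
          push_cast
          module
        rw [h4]
        refine (norm_add_le _ _).trans ((add_le_add h2 h3).trans (le_of_eq ?_))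
        push_cast
        ring
    have h2 := hpow N le_rfl
    have h3 : ‖e (g i ^ N) - e 1‖ < ρ / 4 := (hg i hi N le_rfl).2
    have h4 : ‖(N : ℝ) • (e (g i) - e 1)‖ = N * ‖e (g i) - e 1‖ := by
      rw [norm_smul, Real.norm_natCast]
    have h5 := norm_sub_norm_le ((N : ℝ) • (e (g i) - e 1)) (e (g i ^ N) - e 1)
    rw [norm_sub_rev ((N : ℝ) • (e (g i) - e 1)), h4] at h5
    rw [le_div_iff₀ hNpos]
    linarith
  -- Each factor lengthens the product by at most `3 / 2` of its own size, so the partial products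
  -- never leave the `ρ`-ball where the estimate is valid.
  have hprod : ∀ k ≤ N, P k ∈ e.source ∧ ‖e (P k) - e 1‖ ≤ k * (3 / 2 * (ρ / 2 / N)) := by
    intro k
    induction k with
    | zero => simp [hP0, h1]
    | succ k ih =>
      intro hk
      obtain ⟨hs, hn⟩ := ih (by omega)
      have hlt : ‖e (P k) - e 1‖ < ρ := by
        refine hn.trans_lt ?_
        have : (k : ℝ) ≤ N := by exact_mod_cast (by omega : k ≤ N)
        calc (k : ℝ) * (3 / 2 * (ρ / 2 / N)) ≤ N * (3 / 2 * (ρ / 2 / N)) := by gcongr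
          _ = 3 / 4 * ρ := by field_simp; ring
          _ < ρ := by linarith
      have h2 := hmul (g k) (by simpa using hWg k (by omega) 1 hN) _ (hsmall _ hs hlt).2
      rw [hP]
      refine ⟨h2.1, ?_⟩
      have h3 := h2.2
      have h4 := hgN k (by omega)
      have h5 : e (g k * P k) - e 1
          = ((e (g k * P k) - e 1) - (e (P k) - e 1) - (e (g k) - e 1))
            + (e (P k) - e 1) + (e (g k) - e 1) := by abel
      rw [h5]
      refine (norm_add₃_le).trans ?_
      push_cast
      linarith
  obtain ⟨hs, hn⟩ := hprod N le_rfl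
  refine (hsmall _ hs (hn.trans_lt ?_)).1
  have : (N : ℝ) * (3 / 2 * (ρ / 2 / N)) = 3 / 4 * ρ := by field_simp; ring
  linarith

/-- The chart at `1` of a Lie group satisfies the differentiability hypothesis of
`exists_nhds_one_prod_mem`. -/
theorem LieGroup.hasStrictFDerivAt_chart_mul [ChartedSpace E G] {k : WithTop ℕ∞}
    [LieGroup 𝓘(ℝ, E) k G] (hk : 1 ≤ k) :
    ∃ A : E × E →L[ℝ] E, HasStrictFDerivAt
      (fun v : E × E => chartAt E (1 : G) ((chartAt E (1 : G)).symm v.1 *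
        (chartAt E (1 : G)).symm v.2)) A (chartAt E (1 : G) 1, chartAt E (1 : G) 1) := by
  have h := (contMDiff_mul 𝓘(ℝ, E) k (G := G)) (1, 1)
  rw [contMDiffAt_iff] at h
  have h2 := h.2
  simp only [mul_one, mfld_simps, Prod.map_id, Set.range_id, contDiffWithinAt_univ] at h2
  have h3 : ContDiffAt ℝ k (fun v : E × E => chartAt E (1 : G) ((chartAt E (1 : G)).symm v.1 *
        (chartAt E (1 : G)).symm v.2)) (chartAt E (1 : G) 1, chartAt E (1 : G) 1) := h2
  exact ⟨_, h3.hasStrictFDerivAt (by intro h0; simp [h0] at hk)⟩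

end Chart

/-! ### The topological vector space `ℓ_{1/2}(ℝ)` -/

namespace EllHalf

open Filter Topology

theorem dist_def (a b : EllHalf) : dist a b = ∑' n, √|a n - b n| := rfl

@[simp] theorem add_apply (a b : EllHalf) (n : ℕ) : (a + b) n = a n + b n := rfl

@[simp] theorem neg_apply (a : EllHalf) (n : ℕ) : (-a) n = -a n := rfl

@[simp] theorem smul_apply (t : ℝ) (a : EllHalf) (n : ℕ) : (t • a) n = t * a n := rfl

@[simp] theorem zero_apply (n : ℕ) : (0 : EllHalf) n = 0 := rfl

@[ext] theorem ext {a b : EllHalf} (h : ∀ n, a n = b n) : a = b := Subtype.ext (funext h)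

theorem dist_add_left (a b c : EllHalf) : dist (a + b) (a + c) = dist b c := by
  simp [dist_def]

theorem dist_smul_left (t : ℝ) (a b : EllHalf) : dist (t • a) (t • b) = √|t| * dist a b := by
  simp only [dist_def, smul_apply, ← mul_sub, abs_mul, Real.sqrt_mul (abs_nonneg _), tsum_mul_left]

theorem dist_smul_right (s t : ℝ) (a : EllHalf) : dist (s • a) (t • a) = √|s - t| * dist a 0 := by
  simp only [dist_def, smul_apply, ← sub_mul, abs_mul, Real.sqrt_mul (abs_nonneg _), tsum_mul_left,
    zero_apply, sub_zero]

theorem dist_neg_neg (a b : EllHalf) : dist (-a) (-b) = dist a b := by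
  simp only [dist_def, neg_apply, neg_sub_neg, abs_sub_comm]

theorem isTopologicalAddGroup : IsTopologicalAddGroup EllHalf where
  continuous_add := by
    refine continuous_iff_continuousAt.mpr fun ⟨a, b⟩ => ?_
    refine tendsto_iff_dist_tendsto_zero.mpr ?_
    refine squeeze_zero (g := fun q : EllHalf × EllHalf => dist q.2 b + dist q.1 a)
      (fun _ => dist_nonneg) (fun q => ?_) ?_
    · refine (dist_triangle _ (q.1 + b) _).trans (le_of_eq ?_)
      change _ + dist (q.1 + b) (a + b) = _
      rw [dist_add_left, add_comm q.1 b, add_comm a b, dist_add_left]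
    · have : Continuous fun q : EllHalf × EllHalf => dist q.2 b + dist q.1 a := by fun_prop
      simpa using this.tendsto (a, b)
  continuous_neg := (Isometry.of_dist_eq dist_neg_neg).continuous

theorem continuousSMul : ContinuousSMul ℝ EllHalf where
  continuous_smul := by
    refine continuous_iff_continuousAt.mpr fun ⟨t, a⟩ => ?_
    refine tendsto_iff_dist_tendsto_zero.mpr ?_
    refine squeeze_zero
      (g := fun q : ℝ × EllHalf => √|q.1| * dist q.2 a + √|q.1 - t| * dist a 0)
      (fun _ => dist_nonneg) (fun q => ?_) ?_
    · refine (dist_triangle _ (q.1 • a) _).trans (le_of_eq ?_)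
      rw [dist_smul_left, dist_smul_right]
    · have : Continuous fun q : ℝ × EllHalf => √|q.1| * dist q.2 a + √|q.1 - t| * dist a 0 := by
        fun_prop
      simpa using this.tendsto (t, a)

/-- The sequence with entry `t` at the positions in `s`, and zero elsewhere. -/
noncomputable def indicator (s : Finset ℕ) (t : ℝ) : EllHalf :=
  ⟨fun n => if n ∈ s then t else 0,
    summable_of_ne_finset_zero (s := s) fun n hn => by simp [hn]⟩

theorem indicator_apply (s : Finset ℕ) (t : ℝ) (n : ℕ) :
    indicator s t n = if n ∈ s then t else 0 := rfl

theorem dist_indicator_zero (s : Finset ℕ) (t : ℝ) : dist (indicator s t) 0 = s.card * √|t| := by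
  rw [dist_def, tsum_eq_sum (s := s) fun n hn => by simp [indicator_apply, hn]]
  rw [Finset.sum_congr rfl fun n hn => by simp [indicator_apply, hn]; rfl]
  simp

theorem nsmul_indicator (k : ℕ) (s : Finset ℕ) (t : ℝ) :
    k • indicator s t = indicator s (k * t) := by
  rw [← Nat.cast_smul_eq_nsmul ℝ]
  ext n
  simp [indicator_apply]

theorem smul_indicator (c : ℝ) (s : Finset ℕ) (t : ℝ) :
    c • indicator s t = indicator s (c * t) := by
  ext n
  simp [indicator_apply]

/-- The new vector stands on the left, to match the recursion `P (i + 1) = g i * P i` of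
`exists_nhds_one_prod_mem`. -/
theorem indicator_range_succ (k : ℕ) (t : ℝ) :
    indicator (Finset.range (k + 1)) t = indicator {k} t + indicator (Finset.range k) t := by
  ext n
  rcases lt_trichotomy n k with h | h | h
  · simp [indicator_apply, h, h.ne, h.trans (Nat.lt_succ_self k)]
  · simp [indicator_apply, h]
  · simp [indicator_apply, h.ne', not_lt.mpr h.le, not_lt.mpr (Nat.succ_le_of_lt h)]

theorem indicator_range (k : ℕ) (t : ℝ) :
    indicator (Finset.range k) t = ∑ i ∈ Finset.range k, indicator {i} t := by
  induction k with
  | zero => ext n; simp [indicator_apply]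
  | succ k ih => rw [indicator_range_succ, Finset.sum_range_succ, ih, add_comm]

/-- The average of `N` vectors with disjoint supports, each at distance `r / 2` from `0`, is at
distance `√N · r / 2`, which is unbounded in `N`. -/
theorem not_locallyConvexSpace : ¬ LocallyConvexSpace ℝ EllHalf := by
  intro h
  obtain ⟨U, ⟨hU, hconv⟩, hsub⟩ :=
    (LocallyConvexSpace.convex_basis (𝕜 := ℝ) (0 : EllHalf)).mem_iff.mp
      (Metric.ball_mem_nhds (0 : EllHalf) one_pos)
  obtain ⟨r, hr, hrU⟩ := Metric.mem_nhds_iff.mp hU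
  obtain ⟨N, hN⟩ := exists_nat_gt ((2 / r) ^ 2)
  have hNpos : (0 : ℝ) < N := lt_of_le_of_lt (by positivity) hN
  have hmem : ∀ i ∈ Finset.range N, indicator {i} ((r / 2) ^ 2) ∈ U := fun i _ => by
    refine hrU ?_
    rw [Metric.mem_ball, dist_indicator_zero, abs_of_nonneg (by positivity),
      Real.sqrt_sq (by positivity)]
    simp
    linarith
  have havg := hconv.sum_mem (t := Finset.range N) (w := fun _ => (N : ℝ)⁻¹)
    (fun _ _ => by positivity) (by simp [hNpos.ne']) hmem
  rw [← Finset.smul_sum, ← indicator_range, smul_indicator] at havg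
  have h2 : _ ∈ Metric.ball (0 : EllHalf) 1 := hsub havg
  rw [Metric.mem_ball, dist_indicator_zero, Finset.card_range, abs_of_nonneg (by positivity),
    Real.sqrt_mul (by positivity), Real.sqrt_sq (by positivity), Real.sqrt_inv] at h2
  have h3 : (2 / r) < √N := Real.lt_sqrt_of_sq_lt hN
  have h4 : (N : ℝ) * ((√N)⁻¹ * (r / 2)) = √N * (r / 2) := by
    have h5 : √(N : ℝ) ≠ 0 := (Real.sqrt_pos.mpr hNpos).ne'
    nth_rewrite 1 [← Real.mul_self_sqrt hNpos.le]
    field_simp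
  rw [h4] at h2
  have h6 : 2 / r * (r / 2) = 1 := by field_simp
  nlinarith

end EllHalf

/-! ### The Heisenberg group -/

namespace Heisenberg

@[simp] theorem mul_x (p q : Heisenberg) : (p * q).x = p.x + q.x := rfl
@[simp] theorem mul_y (p q : Heisenberg) : (p * q).y = p.y + q.y := rfl
@[simp] theorem mul_z (p q : Heisenberg) :
    (p * q).z = p.z + q.z + (p.x * q.y - p.y * q.x) / 2 := rfl
@[simp] theorem one_x : (1 : Heisenberg).x = 0 := rfl
@[simp] theorem one_y : (1 : Heisenberg).y = 0 := rfl
@[simp] theorem one_z : (1 : Heisenberg).z = 0 := rfl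
@[simp] theorem inv_x (p : Heisenberg) : p⁻¹.x = -p.x := rfl
@[simp] theorem inv_y (p : Heisenberg) : p⁻¹.y = -p.y := rfl
@[simp] theorem inv_z (p : Heisenberg) : p⁻¹.z = -p.z := rfl
@[simp] theorem dil_x (t : ℝ) (p : Heisenberg) : (dil t p).x = t * p.x := rfl
@[simp] theorem dil_y (t : ℝ) (p : Heisenberg) : (dil t p).y = t * p.y := rfl
@[simp] theorem dil_z (t : ℝ) (p : Heisenberg) : (dil t p).z = t ^ 2 * p.z := rfl

theorem dil_mul (t : ℝ) (p q : Heisenberg) : dil t (p * q) = dil t p * dil t q := by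
  ext <;> simp <;> ring

@[simp] theorem dil_one (t : ℝ) : dil t 1 = 1 := by ext <;> simp

theorem dil_dil (s t : ℝ) (p : Heisenberg) : dil s (dil t p) = dil (s * t) p := by
  ext <;> simp <;> ring

@[simp] theorem one_dil (p : Heisenberg) : dil 1 p = p := by ext <;> simp

@[simp] theorem zero_dil (p : Heisenberg) : dil 0 p = 1 := by ext <;> simp

/-- The center is the third coordinate axis. -/
theorem mem_center_iff {p : Heisenberg} : p ∈ Subgroup.center Heisenberg ↔ p.x = 0 ∧ p.y = 0 := by
  rw [Subgroup.mem_center_iff]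
  constructor
  · intro h
    have h1 := congrArg z (h ⟨1, 0, 0⟩)
    have h2 := congrArg z (h ⟨0, 1, 0⟩)
    simp at h1 h2
    constructor <;> linarith
  · rintro ⟨hx, hy⟩ g
    ext <;> simp [hx, hy, add_comm]

/-- The element `(0, 0, t)` of the center. -/
def central (t : ℝ) : Heisenberg := ⟨0, 0, t⟩

theorem central_add (s t : ℝ) : central (s + t) = central s * central t := by
  ext <;> simp [central]

/-- The failure of right invariance is purely central, and is given by the symplectic form of the
horizontal parts. -/
theorem inv_mul_mul_eq (p q : Heisenberg) :
    q⁻¹ * p * q = p * central (p.x * q.y - p.y * q.x) := by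
  ext <;> simp [central]
  ring

variable [MetricSpace Heisenberg]

/-- A homogeneous left-invariant distance on the Heisenberg group. -/
structure IsHomogeneousDist : Prop where
  isHomeomorph : IsHomeomorph coords
  dist_dil : ∀ (t : ℝ) (p q : Heisenberg), dist (dil t p) (dil t q) = |t| * dist p q

namespace IsHomogeneousDist

open Filter Topology

theorem dist_central_pos : 0 < dist (central 1) (1 : Heisenberg) :=
  dist_pos.mpr fun h => by simpa [central] using congrArg z h

theorem continuous_dil (hd : IsHomogeneousDist) (p : Heisenberg) :
    Continuous fun t : ℝ => dil t p := by
  rw [(hd.isHomeomorph.homeomorph).isInducing.continuous_iff]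
  change Continuous fun t : ℝ => (t * p.x, t * p.y, t ^ 2 * p.z)
  fun_prop

/-- The horizontal coordinates are bounded near `1` and homogeneous of degree one, so dilating a
point into a small ball gives a linear bound everywhere. -/
theorem exists_abs_le (hd : IsHomogeneousDist) :
    ∃ C : ℝ, 0 < C ∧ ∀ p : Heisenberg, |p.x| ≤ C * dist p 1 ∧ |p.y| ≤ C * dist p 1 := by
  have hx : Continuous fun p : Heisenberg => |p.x| :=
    (continuous_fst.comp hd.isHomeomorph.continuous).abs
  have hy : Continuous fun p : Heisenberg => |p.y| :=
    ((continuous_fst.comp continuous_snd).comp hd.isHomeomorph.continuous).abs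
  have hnear : ∀ᶠ p : Heisenberg in 𝓝 1, |p.x| < 1 ∧ |p.y| < 1 :=
    (hx.continuousAt.eventually_lt continuousAt_const (by simp)).and
      (hy.continuousAt.eventually_lt continuousAt_const (by simp))
  obtain ⟨r, hr, hball⟩ := Metric.eventually_nhds_iff.mp hnear
  -- The dilation that brings `p` to distance `r / 2` from `1` makes both coordinates less than `1`.
  refine ⟨2 / r, by positivity, fun p => ?_⟩
  rcases eq_or_ne p 1 with rfl | hp
  · simp
  have hD : 0 < dist p 1 := dist_pos.mpr hp
  have hlt : dist (dil (r / (2 * dist p 1)) p) 1 < r := by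
    have h1 := hd.dist_dil (r / (2 * dist p 1)) p 1
    rw [dil_one, abs_of_pos (by positivity)] at h1
    have h2 : r / (2 * dist p 1) * dist p 1 = r / 2 := by field_simp
    linarith
  obtain ⟨h1, h2⟩ := hball hlt
  rw [dil_x, abs_mul, abs_of_pos (by positivity), div_mul_eq_mul_div, div_lt_one (by positivity)]
    at h1
  rw [dil_y, abs_mul, abs_of_pos (by positivity), div_mul_eq_mul_div, div_lt_one (by positivity)]
    at h2
  rw [div_mul_eq_mul_div, le_div_iff₀ hr, le_div_iff₀ hr]
  constructor <;> linarith

variable [IsIsometricSMul Heisenberg Heisenberg]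

/-- For `t ≥ 0` this is homogeneity, as `(0, 0, t)` is the dilate of `(0, 0, 1)` by `√t`. Negative
`t` reduces to `-t` because inversion preserves the distance to `1`. -/
theorem dist_central_one (hd : IsHomogeneousDist) (t : ℝ) :
    dist (central t) 1 = dist (central 1) (1 : Heisenberg) * √|t| := by
  have hpos : ∀ t : ℝ, 0 ≤ t → dist (central t) 1 = dist (central 1) (1 : Heisenberg) * √|t| := by
    intro t ht
    have : central t = dil √t (central 1) := by ext <;> simp [central, ht]
    rw [this, ← dil_one √t, hd.dist_dil, dil_one, abs_of_nonneg (Real.sqrt_nonneg _),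
      abs_of_nonneg ht, mul_comm]
  rcases le_total 0 t with ht | ht
  · exact hpos t ht
  · rw [← abs_neg t, ← hpos (-t) (by linarith), ← dist_mul_left (central (-t)), ← central_add,
      mul_one, dist_comm]
    congr 1
    ext <;> simp [central]

theorem dist_central (hd : IsHomogeneousDist) (s t : ℝ) :
    dist (central s) (central t) = dist (central 1) (1 : Heisenberg) * √|s - t| := by
  rw [← hd.dist_central_one, ← dist_mul_left (central t) (central (s - t)), mul_one,
    ← central_add, add_sub_cancel]

/-- With `r = p'⁻¹ p`, the left side is the distance to `1` of `q⁻¹ r q`, which is `r` times a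
central element whose coordinate is `O(d(r, 1) d(q, 1))`. The distance to `1` of a central element
is a square root, whence the product of square roots. -/
theorem exists_dist_mul_right_le (hd : IsHomogeneousDist) :
    ∃ K : ℝ, 0 ≤ K ∧ ∀ p p' q : Heisenberg,
      dist (p * q) (p' * q) ≤ dist p p' + K * (√(dist p p') * √(dist q 1)) := by
  obtain ⟨C, hC, hle⟩ := hd.exists_abs_le
  refine ⟨dist (central 1) (1 : Heisenberg) * √(2 * C ^ 2), by positivity, fun p p' q => ?_⟩
  have h1 : dist (p * q) (p' * q) = dist (q⁻¹ * (p'⁻¹ * p) * q) 1 := by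
    rw [← dist_mul_left (p' * q) _ 1]
    congr 1 <;> group
  have h2 : dist p p' = dist (p'⁻¹ * p) 1 := by
    rw [← dist_mul_left p' _ 1, mul_one, mul_inv_cancel_left]
  rw [h1, h2, inv_mul_mul_eq]
  set r := p'⁻¹ * p
  refine (dist_triangle _ (r * 1) _).trans ?_
  rw [dist_mul_left, mul_one, add_comm, hd.dist_central_one, mul_assoc,
    ← Real.sqrt_mul dist_nonneg, ← Real.sqrt_mul (by positivity)]
  gcongr
  calc |r.x * q.y - r.y * q.x| ≤ |r.x * q.y| + |r.y * q.x| := abs_sub _ _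
    _ = |r.x| * |q.y| + |r.y| * |q.x| := by rw [abs_mul, abs_mul]
    _ ≤ (C * dist r 1) * (C * dist q 1) + (C * dist r 1) * (C * dist q 1) := by
      gcongr
      exacts [(hle r).1, (hle q).2, (hle r).2, (hle q).1]
    _ = 2 * C ^ 2 * (dist r 1 * dist q 1) := by ring

end IsHomogeneousDist

end Heisenberg

/-! ### Groups with a left-invariant distance -/

/-- Left invariance gives `d(pq, ab) ≤ d(q, b) + d(pb, ab)`, where only right translation by `b`
occurs. For inversion, `d(p⁻¹ a, 1) = d(a, p)`, and right translation by `a⁻¹` gives `p⁻¹ → a⁻¹`. -/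
theorem isTopologicalGroup_of_dist_mul_left {G : Type u} [Group G] [MetricSpace G]
    (hl : ∀ g p q : G, dist (g * p) (g * q) = dist p q)
    (hr : ∀ g : G, Continuous fun p : G => p * g) : IsTopologicalGroup G := by
  have hmul : Continuous fun q : G × G => q.1 * q.2 := by
    refine continuous_iff_continuousAt.mpr fun ⟨a, b⟩ => ?_
    refine tendsto_iff_dist_tendsto_zero.mpr ?_
    refine squeeze_zero (g := fun q : G × G => dist q.2 b + dist (q.1 * b) (a * b))
      (fun _ => dist_nonneg) (fun q => ?_) ?_
    · exact (dist_triangle _ (q.1 * b) _).trans (le_of_eq (by rw [hl]))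
    · have h1 := (hr b).comp (continuous_fst (X := G) (Y := G))
      have : Continuous fun q : G × G => dist q.2 b + dist (q.1 * b) (a * b) :=
        (continuous_snd.dist continuous_const).add (h1.dist continuous_const)
      simpa using this.tendsto (a, b)
  refine { continuous_mul := hmul, continuous_inv := continuous_iff_continuousAt.mpr fun a => ?_ }
  have h1 : Filter.Tendsto (fun p : G => p⁻¹ * a) (nhds a) (nhds 1) := by
    refine tendsto_iff_dist_tendsto_zero.mpr ?_
    have h2 : Filter.Tendsto (fun p : G => dist a p) (nhds a) (nhds (dist a a)) :=
      (continuous_const.dist continuous_id).tendsto a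
    rw [dist_self] at h2
    refine h2.congr fun p => ?_
    rw [← hl p (p⁻¹ * a), mul_one, mul_inv_cancel_left]
  have h2 := ((hr a⁻¹).tendsto 1).comp h1
  rw [one_mul] at h2
  exact h2.congr fun p => by simp

/-! ### The group `ℓ₁(ℍ¹)` -/

namespace Ell1

open Filter Topology

section General

variable {G : Type u} [Group G] [MetricSpace G] [IsIsometricSMul G G]

theorem dist_def (x y : Ell1 G) : dist x y = ∑' n, dist (x n) (y n) := rfl

@[simp] theorem mul_apply (x y : Ell1 G) (n : ℕ) : (x * y) n = x n * y n := rfl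

@[simp] theorem one_apply (n : ℕ) : (1 : Ell1 G) n = 1 := rfl

theorem ext {x y : Ell1 G} (h : ∀ n, x n = y n) : x = y := Subtype.ext (funext h)

theorem dist_mul_left' (g x y : Ell1 G) : dist (g * x) (g * y) = dist x y := by
  simp only [dist_def, mul_apply, dist_mul_left]

/-- The sequence with entry `g` at `n`, and `1` elsewhere. -/
noncomputable def single (n : ℕ) (g : G) : Ell1 G :=
  ⟨Pi.mulSingle n g, summable_of_ne_finset_zero (s := {n}) fun m hm => by
    rw [Pi.mulSingle_eq_of_ne (by simpa using hm), dist_self]⟩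

theorem single_apply_same (n : ℕ) (g : G) : (single n g : Ell1 G) n = g :=
  Pi.mulSingle_eq_same (M := fun _ => G) n g

theorem mem_center_iff {x : Ell1 G} :
    x ∈ Subgroup.center (Ell1 G) ↔ ∀ n, x n ∈ Subgroup.center G := by
  simp only [Subgroup.mem_center_iff]
  constructor
  · intro h n g
    have h1 := congrArg (fun y : Ell1 G => y n) (h (single n g))
    simpa [single_apply_same] using h1
  · exact fun h g => ext fun n => h n (g n)

end General

/-! ### Continuity of the group operations and of the dilations. -/

variable [MetricSpace Heisenberg] [IsIsometricSMul Heisenberg Heisenberg]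

/-- By Cauchy-Schwarz, the entrywise distortions `K √d(xₙ, aₙ) √d(yₙ, 1)` sum to at most `K √d(x, a)
√d(y, 1)`, which tends to `0` as `x → a` with `y` fixed. -/
theorem isTopologicalGroup (hd : Heisenberg.IsHomogeneousDist) :
    IsTopologicalGroup (Ell1 Heisenberg) := by
  refine isTopologicalGroup_of_dist_mul_left dist_mul_left' fun y => ?_
  obtain ⟨K, hK, hle⟩ := hd.exists_dist_mul_right_le
  refine continuous_iff_continuousAt.mpr fun a => ?_
  refine tendsto_iff_dist_tendsto_zero.mpr ?_
  refine squeeze_zero (g := fun x => dist x a + K * (√(dist x a) * √(dist y 1)))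
    (fun _ => dist_nonneg) (fun x => ?_) ?_
  · refine Real.tsum_le_of_sum_le (fun _ => dist_nonneg) fun s => ?_
    calc ∑ n ∈ s, dist (x n * y n) (a n * y n)
        ≤ ∑ n ∈ s, (dist (x n) (a n) + K * (√(dist (x n) (a n)) * √(dist (y n) 1))) :=
          Finset.sum_le_sum fun n _ => hle _ _ _
      _ = ∑ n ∈ s, dist (x n) (a n)
          + K * ∑ n ∈ s, √(dist (x n) (a n)) * √(dist (y n) 1) := by
          rw [Finset.sum_add_distrib, Finset.mul_sum]
      _ ≤ ∑ n ∈ s, dist (x n) (a n)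
          + K * (√(∑ n ∈ s, dist (x n) (a n)) * √(∑ n ∈ s, dist (y n) 1)) := by
          gcongr
          exact Real.sum_sqrt_mul_sqrt_le s (fun _ => dist_nonneg) (fun _ => dist_nonneg)
      _ ≤ dist x a + K * (√(dist x a) * √(dist y 1)) := by
          have h1 := (summable_dist x a).sum_le_tsum s fun _ _ => dist_nonneg
          have h2 := (summable_dist y 1).sum_le_tsum s fun _ _ => dist_nonneg
          simp only [one_apply] at h2
          simp only [dist_def, one_apply]
          gcongr
  · have : Continuous fun x : Ell1 Heisenberg => dist x a + K * (√(dist x a) * √(dist y 1)) := by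
      fun_prop
    simpa using this.tendsto a

/-- The componentwise dilations. -/
noncomputable def dil (hd : Heisenberg.IsHomogeneousDist) (t : ℝ) (x : Ell1 Heisenberg) :
    Ell1 Heisenberg :=
  ⟨fun n => Heisenberg.dil t (x n), by
    refine (Summable.mul_left |t| x.2).congr fun n => ?_
    rw [← hd.dist_dil, Heisenberg.dil_one]⟩

theorem dil_apply (hd : Heisenberg.IsHomogeneousDist) (t : ℝ) (x : Ell1 Heisenberg) (n : ℕ) :
    dil hd t x n = Heisenberg.dil t (x n) := rfl

theorem dist_dil (hd : Heisenberg.IsHomogeneousDist) (t : ℝ) (x y : Ell1 Heisenberg) :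
    dist (dil hd t x) (dil hd t y) = |t| * dist x y := by
  simp only [dist_def, dil_apply, hd.dist_dil, tsum_mul_left]

/-- Each entry is continuous in `s`, and homogeneity dominates the `n`-th term by a fixed multiple
of `d(xₙ, 1)` for `s` near `t`; dominated convergence applies to the sum. -/
theorem tendsto_dist_dil (hd : Heisenberg.IsHomogeneousDist) (t : ℝ) (x : Ell1 Heisenberg) :
    Tendsto (fun s => dist (dil hd s x) (dil hd t x)) (𝓝 t) (𝓝 0) := by
  have h := tendsto_tsum_of_dominated_convergence (𝓕 := 𝓝 t)
    (f := fun s n => dist (dil hd s x n) (dil hd t x n)) (g := fun _ : ℕ => (0 : ℝ))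
    (bound := fun n => (|t| + 1 + |t|) * dist (x n) 1) (x.2.mul_left _) (fun n => ?_) ?_
  · rw [tsum_zero] at h
    exact h
  · have h1 : Continuous fun s => dist (dil hd s x n) (dil hd t x n) :=
      (hd.continuous_dil (x n)).dist continuous_const
    simpa using h1.tendsto t
  · have h1 : ∀ᶠ s in 𝓝 t, |s| < |t| + 1 :=
      continuous_abs.continuousAt.eventually_lt continuousAt_const (by simp)
    filter_upwards [h1] with s hs n
    rw [Real.norm_of_nonneg dist_nonneg]
    refine (dist_triangle_right _ _ (1 : Heisenberg)).trans ?_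
    rw [add_mul, dil_apply, dil_apply]
    have h2 : ∀ r : ℝ, dist (Heisenberg.dil r (x n)) 1 = |r| * dist (x n) 1 := fun r => by
      rw [← hd.dist_dil, Heisenberg.dil_one]
    rw [h2, h2]
    gcongr

theorem isMetricScalableGroup (hd : Heisenberg.IsHomogeneousDist) :
    IsMetricScalableGroup (Ell1 Heisenberg) (dil hd) where
  isTopologicalGroup := isTopologicalGroup hd
  continuous_dil := by
    refine continuous_iff_continuousAt.mpr fun ⟨t, x⟩ => ?_
    refine tendsto_iff_dist_tendsto_zero.mpr ?_
    refine squeeze_zero (g := fun q : ℝ × Ell1 Heisenberg =>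
      |q.1| * dist q.2 x + dist (dil hd q.1 x) (dil hd t x)) (fun _ => dist_nonneg) (fun q => ?_) ?_
    · refine (dist_triangle _ (dil hd q.1 x) _).trans (le_of_eq ?_)
      rw [dist_dil]
    · have h1 : Continuous fun q : ℝ × Ell1 Heisenberg => |q.1| * dist q.2 x := by fun_prop
      have h2 := (h1.tendsto (t, x)).add
        ((tendsto_dist_dil hd t x).comp (continuous_fst.tendsto (t, x)))
      simpa using h2
  map_mul t _ p q := ext fun n => Heisenberg.dil_mul t (p n) (q n)
  bijective t ht := by
    refine Function.bijective_iff_has_inverse.mpr ⟨dil hd t⁻¹, fun p => ext fun n => ?_,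
      fun p => ext fun n => ?_⟩
    · simp [dil_apply, Heisenberg.dil_dil, ht]
    · simp [dil_apply, Heisenberg.dil_dil, ht]
  comp s t p := ext fun n => Heisenberg.dil_dil s t (p n)
  zero p := ext fun n => Heisenberg.zero_dil (p n)
  dist_mul_left := dist_mul_left'
  dist_dil := dist_dil hd

/-! ### The center and `ℓ_{1/2}(ℝ)`. -/

/-- The embedding of `ℓ_{1/2}(ℝ)` onto the center of `ℓ₁(ℍ¹)`. -/
noncomputable def ofEllHalf (hd : Heisenberg.IsHomogeneousDist) (a : EllHalf) : Ell1 Heisenberg :=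
  ⟨fun n => Heisenberg.central (a n), by
    refine (Summable.mul_left (dist (Heisenberg.central 1) 1) a.2).congr fun n => ?_
    exact (hd.dist_central_one (a n)).symm⟩

theorem ofEllHalf_apply (hd : Heisenberg.IsHomogeneousDist) (a : EllHalf) (n : ℕ) :
    ofEllHalf hd a n = Heisenberg.central (a n) := rfl

theorem ofEllHalf_add (hd : Heisenberg.IsHomogeneousDist) (a b : EllHalf) :
    ofEllHalf hd (a + b) = ofEllHalf hd a * ofEllHalf hd b :=
  ext fun n => Heisenberg.central_add (a n) (b n)

theorem ofEllHalf_zero (hd : Heisenberg.IsHomogeneousDist) : ofEllHalf hd 0 = 1 := rfl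

theorem ofEllHalf_nsmul (hd : Heisenberg.IsHomogeneousDist) (k : ℕ) (a : EllHalf) :
    ofEllHalf hd (k • a) = ofEllHalf hd a ^ k := by
  induction k with
  | zero => simp [ofEllHalf_zero]
  | succ k ih => rw [succ_nsmul, ofEllHalf_add, ih, pow_succ]

theorem dist_ofEllHalf (hd : Heisenberg.IsHomogeneousDist) (a b : EllHalf) :
    dist (ofEllHalf hd a) (ofEllHalf hd b)
      = dist (Heisenberg.central 1) (1 : Heisenberg) * dist a b := by
  simp only [dist_def, EllHalf.dist_def, ofEllHalf_apply, hd.dist_central, tsum_mul_left]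

theorem ofEllHalf_mem_center (hd : Heisenberg.IsHomogeneousDist) (a : EllHalf) :
    ofEllHalf hd a ∈ Subgroup.center (Ell1 Heisenberg) :=
  mem_center_iff.mpr fun _ => Heisenberg.mem_center_iff.mpr ⟨rfl, rfl⟩

/-- Central entries are `(0, 0, aₙ)`, and since their distance to `1` is `c √|aₙ|` with `c > 0`,
summability of the distances is exactly membership of `a` in `ℓ_{1/2}(ℝ)`. -/
theorem exists_ofEllHalf_eq (hd : Heisenberg.IsHomogeneousDist) {x : Ell1 Heisenberg}
    (hx : x ∈ Subgroup.center (Ell1 Heisenberg)) : ∃ a, ofEllHalf hd a = x := by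
  have hx' : ∀ n, x n = Heisenberg.central (x n).z := fun n => by
    obtain ⟨h1, h2⟩ := Heisenberg.mem_center_iff.mp (mem_center_iff.mp hx n)
    exact Heisenberg.ext h1 h2 rfl
  refine ⟨⟨fun n => (x n).z, ?_⟩, ext fun n => (hx' n).symm⟩
  refine (Summable.mul_left (dist (Heisenberg.central 1) 1)⁻¹ x.2).congr fun n => ?_
  change (dist (Heisenberg.central 1) 1)⁻¹ * dist (x n) 1 = √|(x n).z|
  rw [hx' n, hd.dist_central_one (x n).z,
    inv_mul_cancel_left₀ Heisenberg.IsHomogeneousDist.dist_central_pos.ne']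
  rfl

/-- The isomorphism of `ℓ_{1/2}(ℝ)` with the center of `ℓ₁(ℍ¹)`, as a group isomorphism. -/
noncomputable def ellHalfMulEquivCenter (hd : Heisenberg.IsHomogeneousDist) :
    Multiplicative EllHalf ≃* Subgroup.center (Ell1 Heisenberg) :=
  MulEquiv.ofBijective
    (MonoidHom.mk' (fun a => ⟨ofEllHalf hd a.toAdd, ofEllHalf_mem_center hd _⟩)
      fun a b => Subtype.ext (ofEllHalf_add hd a.toAdd b.toAdd)) <| by
    constructor
    · intro a b hab
      have h1 : ofEllHalf hd a.toAdd = ofEllHalf hd b.toAdd := congrArg Subtype.val hab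
      have h2 := dist_ofEllHalf hd a.toAdd b.toAdd
      rw [h1, dist_self, eq_comm, mul_eq_zero, or_iff_right
        Heisenberg.IsHomogeneousDist.dist_central_pos.ne', dist_eq_zero] at h2
      exact Multiplicative.toAdd.injective h2
    · rintro ⟨x, hx⟩
      obtain ⟨a, ha⟩ := exists_ofEllHalf_eq hd hx
      exact ⟨Multiplicative.ofAdd a, Subtype.ext ha⟩

theorem dist_ellHalfMulEquivCenter (hd : Heisenberg.IsHomogeneousDist)
    (a b : Multiplicative EllHalf) :
    dist (ellHalfMulEquivCenter hd a) (ellHalfMulEquivCenter hd b)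
      = dist (Heisenberg.central 1) (1 : Heisenberg) * dist a b :=
  dist_ofEllHalf hd a.toAdd b.toAdd

/-- The isomorphism of `ℓ_{1/2}(ℝ)` with the center of `ℓ₁(ℍ¹)`, as topological groups. -/
noncomputable def ellHalfEquivCenter (hd : Heisenberg.IsHomogeneousDist) :
    Multiplicative EllHalf ≃ₜ* Subgroup.center (Ell1 Heisenberg) where
  toMulEquiv := ellHalfMulEquivCenter hd
  continuous_toFun := by
    refine LipschitzWith.continuous (K := ⟨dist (Heisenberg.central 1) 1, dist_nonneg⟩)
      (LipschitzWith.of_dist_le_mul fun a b => ?_)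
    exact (dist_ellHalfMulEquivCenter hd a b).le
  continuous_invFun := by
    refine LipschitzWith.continuous (K := ⟨(dist (Heisenberg.central 1) 1)⁻¹, by positivity⟩)
      (LipschitzWith.of_dist_le_mul fun x y => ?_)
    obtain ⟨a, rfl⟩ := (ellHalfMulEquivCenter hd).surjective x
    obtain ⟨b, rfl⟩ := (ellHalfMulEquivCenter hd).surjective y
    rw [dist_ellHalfMulEquivCenter]
    change dist ((ellHalfMulEquivCenter hd).symm _) ((ellHalfMulEquivCenter hd).symm _)
      ≤ (dist (Heisenberg.central 1) (1 : Heisenberg))⁻¹ * _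
    rw [MulEquiv.symm_apply_apply, MulEquiv.symm_apply_apply,
      inv_mul_cancel_left₀ Heisenberg.IsHomogeneousDist.dist_central_pos.ne']

/-! ### Multiplication is not differentiable in any chart. -/

/-- No chart of `ℓ₁(ℍ¹)` around `1` in a normed space makes the multiplication strictly
differentiable: the center is not locally convex. -/
theorem not_hasStrictFDerivAt_chart_mul (hd : Heisenberg.IsHomogeneousDist)
    {E : Type v} [NormedAddCommGroup E] [NormedSpace ℝ E]
    (e : OpenPartialHomeomorph (Ell1 Heisenberg) E) (h1 : (1 : Ell1 Heisenberg) ∈ e.source)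
    (A : E × E →L[ℝ] E) :
    ¬ HasStrictFDerivAt (fun v : E × E => e (e.symm v.1 * e.symm v.2)) A (e 1, e 1) := by
  intro hA
  have := isTopologicalGroup hd
  set c := dist (Heisenberg.central 1) (1 : Heisenberg)
  have hc : 0 < c := Heisenberg.IsHomogeneousDist.dist_central_pos
  obtain ⟨V, hV, hprod⟩ := exists_nhds_one_prod_mem e h1 hA (Metric.ball_mem_nhds 1 one_pos)
  obtain ⟨r, hr, hrV⟩ := Metric.mem_nhds_iff.mp hV
  have hdist : ∀ (s : Finset ℕ) (t : ℝ), 0 ≤ t →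
      dist (ofEllHalf hd (EllHalf.indicator s (t ^ 2))) 1 = c * (s.card * t) := fun s t ht => by
    rw [← ofEllHalf_zero hd, dist_ofEllHalf, EllHalf.dist_indicator_zero,
      abs_of_nonneg (by positivity), Real.sqrt_sq ht]
  -- There are `M²` factors, with entries `t²` so that square roots disappear. Powers up to the
  -- `M²`-th stay within `c M t = r / 2`, while the product has distance `c M² t = M r / 2 > 1`.
  obtain ⟨M, hM⟩ := exists_nat_gt (2 / r)
  have hMpos : (0 : ℝ) < M := lt_of_le_of_lt (by positivity) hM
  set t : ℝ := r / (2 * c) / M with ht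
  have htpos : 0 < t := by positivity
  have hmem := hprod (M ^ 2) (fun i => ofEllHalf hd (EllHalf.indicator {i} (t ^ 2)))
    (fun k => ofEllHalf hd (EllHalf.indicator (Finset.range k) (t ^ 2)))
    (by exact_mod_cast pow_pos hMpos 2) (fun i _ k hk => hrV ?_) ?_ fun i => ?_
  · rw [Metric.mem_ball, hdist _ _ htpos.le, Finset.card_range, ht] at hmem
    push_cast at hmem
    have h2 : c * ((M : ℝ) ^ 2 * (r / (2 * c) / M)) = M * r / 2 := by field_simp
    rw [h2] at hmem
    rw [div_lt_iff₀ hr] at hM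
    linarith
  · have hk' : √(k : ℝ) ≤ M := Real.sqrt_le_iff.mpr ⟨hMpos.le, by exact_mod_cast hk⟩
    have h2 : (k : ℝ) * t ^ 2 = (√k * t) ^ 2 := by
      rw [mul_pow, Real.sq_sqrt (Nat.cast_nonneg k)]
    rw [← ofEllHalf_nsmul, EllHalf.nsmul_indicator, h2, Metric.mem_ball, hdist _ _ (by positivity)]
    calc c * (({i} : Finset ℕ).card * (√k * t)) ≤ c * (1 * (M * t)) := by
          rw [Finset.card_singleton, Nat.cast_one]
          gcongr
      _ = r / 2 := by rw [ht]; field_simp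
      _ < r := by linarith
  · rw [← ofEllHalf_zero hd]
    congr 1
  · rw [EllHalf.indicator_range_succ, ofEllHalf_add]

theorem not_isBanachLieGroup (hd : Heisenberg.IsHomogeneousDist) {k : WithTop ℕ∞} (hk : 1 ≤ k) :
    ¬ IsBanachLieGroup.{0, v} k (Ell1 Heisenberg) := by
  rintro ⟨E, _, _, _, _, _⟩
  obtain ⟨A, hA⟩ := LieGroup.hasStrictFDerivAt_chart_mul (E := E) (G := Ell1 Heisenberg) hk
  exact not_hasStrictFDerivAt_chart_mul hd _ (mem_chart_source E _) A hA

end Ell1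

/-! ### Graded Banach Lie algebras -/

namespace GradedBanachLieAlgebra

open Filter Topology
open scoped NNReal

variable {E : Type v} [NormedAddCommGroup E] [NormedSpace ℝ E] (L : GradedBanachLieAlgebra E)

/-! #### Iterated brackets -/

theorem nested_cons (a : E) {l : List E} (hl : l ≠ []) :
    L.nested (a :: l) = L.bracket a (L.nested l) := by
  cases l with
  | nil => exact absurd rfl hl
  | cons b l => rfl

/-- The innermost bracket is between two multiples of the same vector. -/
theorem nested_eq_zero {x : E} {l : List E} (hl : 2 ≤ l.length)
    (h : ∀ a ∈ l, a ∈ Submodule.span ℝ {x}) : L.nested l = 0 := by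
  induction l with
  | nil => simp at hl
  | cons a l ih =>
    rw [L.nested_cons a (by rintro rfl; simp at hl)]
    rcases l with _ | ⟨b, _ | ⟨c, l⟩⟩
    · simp at hl
    · obtain ⟨s, rfl⟩ := Submodule.mem_span_singleton.mp (h a (by simp))
      obtain ⟨t, rfl⟩ := Submodule.mem_span_singleton.mp (h b (by simp))
      simp [nested, L.bracket_self]
    · rw [ih (by simp) fun d hd => h d (List.mem_cons_of_mem _ hd), map_zero]

/-- The base `1 + ‖L.bracket‖` is at least `1`, so the exponent can be the length rather than the
number of brackets. -/
theorem norm_nested_le (l : List E) :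
    ‖L.nested l‖ ≤ (1 + ‖L.bracket‖) ^ l.length * (l.map norm).prod := by
  induction l with
  | nil => simp [nested]
  | cons a l ih =>
    rcases eq_or_ne l [] with rfl | hl
    · simpa [nested] using le_mul_of_one_le_left (norm_nonneg a) (le_add_of_nonneg_right
        (norm_nonneg L.bracket))
    · rw [L.nested_cons a hl, List.length_cons, List.map_cons, List.prod_cons, pow_succ]
      calc ‖L.bracket a (L.nested l)‖ ≤ ‖L.bracket‖ * ‖a‖ * ‖L.nested l‖ := L.bracket.le_opNorm₂ _ _
        _ ≤ (1 + ‖L.bracket‖) * ‖a‖ * ((1 + ‖L.bracket‖) ^ l.length * (l.map norm).prod) := by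
          gcongr
          linarith
        _ = _ := by ring

/-- The iterated bracket along a word in two letters, `x` for `true` and `y` for `false`. -/
noncomputable def word (w : List Bool) (x y : E) : E := L.nested (w.map fun b => cond b x y)

theorem word_cons (b : Bool) {w : List Bool} (hw : w ≠ []) (x y : E) :
    L.word (b :: w) x y = L.bracket (cond b x y) (L.word w x y) := by
  rw [word, List.map_cons, L.nested_cons _ (by simpa using hw), word]

theorem contDiff_word (w : List Bool) : ContDiff ℝ 1 fun p : E × E => L.word w p.1 p.2 := by
  induction w with
  | nil => exact contDiff_const
  | cons b w ih =>
    have hb : ContDiff ℝ 1 fun p : E × E => cond b p.1 p.2 := by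
      cases b
      exacts [contDiff_snd, contDiff_fst]
    rcases eq_or_ne w [] with rfl | hw
    · exact hb
    · simp only [L.word_cons b hw]
      exact (L.bracket.contDiff.comp hb).clm_apply ih

theorem prod_map_cond (w : List Bool) (a b : ℝ) :
    (w.map fun c => cond c a b).prod = a ^ w.count true * b ^ w.count false := by
  induction w with
  | nil => simp
  | cons c w ih => cases c <;> simp [ih, pow_succ] <;> ring

/-- A word in a single letter vanishes. Otherwise both letters occur, and in the unit ball all
further factors `‖x‖`, `‖y‖` can be dropped. -/
theorem norm_word_le {w : List Bool} (hw : 2 ≤ w.length) {x y : E} (hx : ‖x‖ ≤ 1) (hy : ‖y‖ ≤ 1) :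
    ‖L.word w x y‖ ≤ (1 + ‖L.bracket‖) ^ w.length * (‖x‖ * ‖y‖) := by
  have h0 : ∀ z : E, (∀ b ∈ w, cond b x y = z) → ‖L.word w x y‖ ≤
      (1 + ‖L.bracket‖) ^ w.length * (‖x‖ * ‖y‖) := fun z hz => by
    rw [word, L.nested_eq_zero (x := z) (by simpa using hw), norm_zero]
    · positivity
    · intro a ha
      obtain ⟨b, hb, rfl⟩ := List.mem_map.mp ha
      rw [hz b hb]
      exact Submodule.mem_span_singleton_self z
  by_cases ht : true ∈ w
  · by_cases hf : false ∈ w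
    · refine (L.norm_nested_le _).trans ?_
      have h1 : ((w.map fun b => cond b x y).map norm) = w.map fun b => cond b ‖x‖ ‖y‖ := by
        rw [List.map_map]
        refine List.map_congr_left fun b _ => ?_
        cases b <;> rfl
      rw [h1, prod_map_cond, List.length_map]
      gcongr
      · exact pow_le_of_le_one (norm_nonneg _) hx (List.count_pos_iff.mpr ht).ne'
      · exact pow_le_of_le_one (norm_nonneg _) hy (List.count_pos_iff.mpr hf).ne'
    · refine h0 x fun b hb => ?_
      cases b
      exacts [absurd hb hf, rfl]
  · refine h0 y fun b hb => ?_
    cases b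
    exacts [rfl, absurd hb ht]

/-! #### The grading and the dilations -/

theorem bracket_eq_sum (x y : E) : L.bracket x y =
    ∑ i ∈ Finset.Icc 1 L.step, ∑ j ∈ Finset.Icc 1 L.step, L.bracket (L.π i x) (L.π j y) := by
  conv_lhs => rw [← L.sum_π x, ← L.sum_π y]
  simp only [map_sum, sum_apply]
  exact Finset.sum_comm

theorem ext_π {x y : E} (h : ∀ i ∈ Finset.Icc 1 L.step, L.π i x = L.π i y) : x = y := by
  rw [← L.sum_π x, ← L.sum_π y]
  exact Finset.sum_congr rfl h

/-- Brackets of layers `i, j ≥ 1` lie in layer `i + j ≥ 2`. -/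
theorem π_one_bracket (x y : E) : L.π 1 (L.bracket x y) = 0 := by
  rw [L.bracket_eq_sum, map_sum]
  refine Finset.sum_eq_zero fun i hi => ?_
  rw [map_sum]
  refine Finset.sum_eq_zero fun j hj => ?_
  rw [← L.π_bracket, L.π_π_of_ne]
  simp only [Finset.mem_Icc] at hi hj
  omega

/-- The dilation `δ_t`, as a continuous linear map. -/
noncomputable def dilCLM (t : ℝ) : E →L[ℝ] E := ∑ i ∈ Finset.Icc 1 L.step, t ^ i • L.π i

theorem dilCLM_apply (t : ℝ) (x : E) : L.dilCLM t x = L.dil t x := by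
  simp [dilCLM, dil]

theorem π_dil (t : ℝ) (i : ℕ) (x : E) : L.π i (L.dil t x) = t ^ i • L.π i x := by
  rw [dil, map_sum, Finset.sum_eq_single i]
  · rw [map_smul, L.π_π_same]
  · intro j _ hj
    rw [map_smul, L.π_π_of_ne i j x hj.symm, smul_zero]
  · intro hi
    rw [L.π_eq_zero i hi]
    simp

theorem dil_π (t : ℝ) (i : ℕ) (x : E) : L.dil t (L.π i x) = t ^ i • L.π i x := by
  refine L.ext_π fun j _ => ?_
  rw [L.π_dil, map_smul]
  rcases eq_or_ne j i with rfl | h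
  · rfl
  · rw [L.π_π_of_ne j i x h, smul_zero, smul_zero]

theorem dil_dil (s t : ℝ) (x : E) : L.dil s (L.dil t x) = L.dil (s * t) x :=
  L.ext_π fun i _ => by rw [L.π_dil, L.π_dil, L.π_dil, smul_smul, mul_pow]

@[simp] theorem dil_one_left (x : E) : L.dil 1 x = x := L.ext_π fun i _ => by simp [L.π_dil]

theorem dil_zero_left (x : E) : L.dil 0 x = 0 :=
  L.ext_π fun i hi => by
    rw [L.π_dil, zero_pow (by simp only [Finset.mem_Icc] at hi; omega), zero_smul, map_zero]

theorem continuous_dil : Continuous fun q : ℝ × E => L.dil q.1 q.2 := by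
  unfold dil
  fun_prop

theorem dil_bracket (t : ℝ) (x y : E) :
    L.dil t (L.bracket x y) = L.bracket (L.dil t x) (L.dil t y) := by
  rw [L.bracket_eq_sum x y, L.bracket_eq_sum (L.dil t x), ← dilCLM_apply]
  simp only [map_sum, L.π_dil, map_smul, smul_apply, smul_smul, ← pow_add]
  refine Finset.sum_congr rfl fun i _ => Finset.sum_congr rfl fun j _ => ?_
  rw [dilCLM_apply, ← L.π_bracket, L.dil_π, add_comm j i]

theorem dil_word (t : ℝ) (w : List Bool) (x y : E) :
    L.dil t (L.word w x y) = L.word w (L.dil t x) (L.dil t y) := by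
  induction w with
  | nil => simp [word, nested, ← dilCLM_apply]
  | cons b w ih =>
    rcases eq_or_ne w [] with rfl | hw
    · cases b <;> rfl
    · rw [L.word_cons b hw, L.word_cons b hw, L.dil_bracket, ih]
      cases b <;> rfl

/-! #### The Baker-Campbell-Hausdorff product -/

/-- The combinations of iterated brackets of at least two elements. -/
def higherBrackets : Submodule ℝ (E → E → E) := Submodule.span ℝ (L.word '' {w | 2 ≤ w.length})

/-- The difference between the Baker-Campbell-Hausdorff product and the sum. -/
noncomputable def bchRemainder (x y : E) : E := L.bch x y - (x + y)

open scoped Nat in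
/-- Up to iterated brackets of at least two elements, the Baker-Campbell-Hausdorff product is the
sum. -/
theorem bchRemainder_mem : L.bchRemainder ∈ L.higherBrackets := by
  -- For `step = 0` the Dynkin sum is empty and lacks its linear terms, but the space is trivial.
  rcases Nat.eq_zero_or_pos L.step with h0 | h0
  · have hz : ∀ z : E, z = 0 := fun z => L.ext_π fun i hi => by simp [h0] at hi
    have : L.bchRemainder = (0 : E → E → E) := by
      funext x y
      exact hz _
    rw [this]
    exact zero_mem _
  let W : ∀ {n : ℕ}, (Fin n → ℕ × ℕ) → List Bool := fun f =>
    (List.ofFn f).flatMap fun q => List.replicate q.1 true ++ List.replicate q.2 false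
  have hWlen : ∀ {n : ℕ} (f : Fin n → ℕ × ℕ), (W f).length = ∑ i, ((f i).1 + (f i).2) := by
    intro n f
    simp only [W, List.length_flatMap, List.length_append, List.length_replicate, List.map_ofFn,
      List.sum_ofFn, Function.comp_apply]
  let S : ∀ n : ℕ, Finset (Fin n → ℕ × ℕ) := fun n => Fintype.piFinset fun _ : Fin n =>
    (Finset.range (L.step + 1) ×ˢ Finset.range (L.step + 1)).filter fun q => 0 < q.1 + q.2
  have hS : ∀ {n : ℕ} {f : Fin n → ℕ × ℕ}, f ∈ S n → ∀ i, 0 < (f i).1 + (f i).2 :=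
    fun hf i => (Finset.mem_filter.mp (Fintype.mem_piFinset.mp hf i)).2
  let F : ∀ {n : ℕ}, (Fin n → ℕ × ℕ) → E → E → E := fun {n} f =>
    ((-1 : ℝ) ^ (n - 1) /
      (n * (∑ i, (((f i).1 : ℝ) + (f i).2)) * ∏ i, (((f i).1 ! : ℝ) * (f i).2 !))) • L.word (W f)
  have hF : ∀ {n : ℕ} (f : Fin n → ℕ × ℕ), 2 ≤ ∑ i, ((f i).1 + (f i).2) →
      F f ∈ L.higherBrackets := fun f hf =>
    Submodule.smul_mem _ _ (Submodule.subset_span ⟨W f, by rw [← hWlen] at hf; exact hf, rfl⟩)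
  have hbch : L.bch = ∑ n ∈ Finset.Icc 1 L.step, ∑ f ∈ S n, F f := by
    funext x y
    simp only [Finset.sum_apply, bch, F, S, W, Pi.smul_apply, word, List.map_flatMap,
      List.map_append, List.map_replicate, cond_true, cond_false]
  -- These two exponents, with `n = 1`, contribute the terms `x` and `y`.
  let f₁ : Fin 1 → ℕ × ℕ := fun _ => (1, 0)
  let f₂ : Fin 1 → ℕ × ℕ := fun _ => (0, 1)
  have hf₁ : f₁ ∈ S 1 := by simp [S, f₁, h0]
  have hf₂ : f₂ ∈ (S 1).erase f₁ := by
    refine Finset.mem_erase.mpr ⟨fun h => ?_, by simp [S, f₂, h0]⟩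
    simpa [f₁, f₂] using congrFun h 0
  have hF₁ : F f₁ = fun x _ => x := by
    funext x y
    simp [F, f₁, W, word, nested]
  have hF₂ : F f₂ = fun _ y => y := by
    funext x y
    simp [F, f₂, W, word, nested]
  have key : L.bchRemainder = ∑ f ∈ ((S 1).erase f₁).erase f₂, F f
      + ∑ n ∈ (Finset.Icc 1 L.step).erase 1, ∑ f ∈ S n, F f := by
    have h1 := Finset.add_sum_erase (Finset.Icc 1 L.step) (fun n => ∑ f ∈ S n, F f)
      (Finset.mem_Icc.mpr ⟨le_rfl, h0⟩)
    have h2 := Finset.add_sum_erase (S 1) (fun f => F f) hf₁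
    have h3 := Finset.add_sum_erase ((S 1).erase f₁) (fun f => F f) hf₂
    have h4 : L.bchRemainder = L.bch - (F f₁ + F f₂) := by
      rw [hF₁, hF₂]
      rfl
    rw [h4, hbch, ← h1, ← h2, ← h3]
    abel
  rw [key]
  -- Every other word has length at least two: for `n = 1` because its total exponent is positive
  -- and both exponents of total one are removed, for `n ≥ 2` because each of the `n` blocks is
  -- nonempty.
  refine add_mem (sum_mem fun f hf => hF f ?_) (sum_mem fun n hn => sum_mem fun f hf => hF f ?_)
  · simp only [Finset.mem_erase] at hf
    obtain ⟨hn2, hn1, hf⟩ := hf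
    have hpos := hS hf 0
    rw [Fin.sum_univ_one]
    by_contra hlt
    have h01 : f 0 = (1, 0) ∨ f 0 = (0, 1) := by
      rcases hab : f 0 with ⟨a, b⟩
      rw [hab] at hpos hlt
      simp only [Prod.mk.injEq] at *
      omega
    rcases h01 with h | h
    · exact hn1 (funext fun i => by rw [Subsingleton.elim i 0, h])
    · exact hn2 (funext fun i => by rw [Subsingleton.elim i 0, h])
  · simp only [Finset.mem_erase, Finset.mem_Icc] at hn
    calc 2 ≤ n := by omega
      _ = ∑ _i : Fin n, 1 := by simp
      _ ≤ _ := Finset.sum_le_sum fun i _ => hS hf i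

variable {L}

/-- This and the next four facts hold for words and pass to linear combinations; they are all that
is needed about the remainder, so the higher Dynkin coefficients play no role. -/
theorem exists_norm_le_of_mem_higherBrackets {R : E → E → E} (hR : R ∈ L.higherBrackets) :
    ∃ K : ℝ, 0 ≤ K ∧ ∀ x y, ‖x‖ ≤ 1 → ‖y‖ ≤ 1 → ‖R x y‖ ≤ K * (‖x‖ * ‖y‖) := by
  induction hR using Submodule.span_induction with
  | mem R h =>
    obtain ⟨w, hw, rfl⟩ := h
    exact ⟨_, by positivity, fun x y hx hy => L.norm_word_le hw hx hy⟩
  | zero => exact ⟨0, le_rfl, by simp⟩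
  | add R R' _ _ h h' =>
    obtain ⟨K, hK, h⟩ := h
    obtain ⟨K', hK', h'⟩ := h'
    refine ⟨K + K', by positivity, fun x y hx hy => ?_⟩
    rw [add_mul]
    exact (norm_add_le _ _).trans (add_le_add (h x y hx hy) (h' x y hx hy))
  | smul c R _ h =>
    obtain ⟨K, hK, h⟩ := h
    refine ⟨|c| * K, by positivity, fun x y hx hy => ?_⟩
    rw [Pi.smul_apply, Pi.smul_apply, norm_smul, Real.norm_eq_abs, mul_assoc]
    gcongr
    exact h x y hx hy

theorem π_one_of_mem_higherBrackets {R : E → E → E} (hR : R ∈ L.higherBrackets) (x y : E) :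
    L.π 1 (R x y) = 0 := by
  induction hR using Submodule.span_induction with
  | mem R h =>
    obtain ⟨w, hw, rfl⟩ := h
    rcases w with _ | ⟨b, _ | ⟨c, w⟩⟩
    · simp at hw
    · simp at hw
    · rw [L.word_cons b (by simp), L.π_one_bracket]
  | zero => simp
  | add R R' _ _ h h' => simp [h, h']
  | smul c R _ h => simp [h]

theorem dil_of_mem_higherBrackets {R : E → E → E} (hR : R ∈ L.higherBrackets) (t : ℝ) (x y : E) :
    L.dil t (R x y) = R (L.dil t x) (L.dil t y) := by
  induction hR using Submodule.span_induction with
  | mem R h =>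
    obtain ⟨w, -, rfl⟩ := h
    exact L.dil_word t w x y
  | zero => simp [← dilCLM_apply]
  | add R R' _ _ h h' =>
    rw [← dilCLM_apply] at h h' ⊢
    simp [h, h']
  | smul c R _ h =>
    rw [← dilCLM_apply] at h ⊢
    simp [h]

theorem apply_neg_of_mem_higherBrackets {R : E → E → E} (hR : R ∈ L.higherBrackets) (x : E) :
    R x (-x) = 0 := by
  induction hR using Submodule.span_induction with
  | mem R h =>
    obtain ⟨w, hw, rfl⟩ := h
    refine L.nested_eq_zero (x := x) (by simpa using hw) fun a ha => ?_
    obtain ⟨b, -, rfl⟩ := List.mem_map.mp ha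
    cases b
    · exact neg_mem (Submodule.mem_span_singleton_self x)
    · exact Submodule.mem_span_singleton_self x
  | zero => rfl
  | add R R' _ _ h h' => simp [h, h']
  | smul c R _ h => simp [h]

theorem contDiff_of_mem_higherBrackets {R : E → E → E} (hR : R ∈ L.higherBrackets) :
    ContDiff ℝ 1 fun p : E × E => R p.1 p.2 := by
  induction hR using Submodule.span_induction with
  | mem R h =>
    obtain ⟨w, -, rfl⟩ := h
    exact L.contDiff_word w
  | zero => exact contDiff_const
  | add R R' _ _ h h' => exact h.add h'
  | smul c R _ h => exact contDiff_const.smul h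

variable (L)

theorem bch_eq (x y : E) : L.bch x y = x + y + L.bchRemainder x y :=
  (add_sub_cancel _ _).symm

theorem contDiff_bch : ContDiff ℝ 1 fun p : E × E => L.bch p.1 p.2 := by
  simp only [bch_eq]
  exact (contDiff_fst.add contDiff_snd).add (contDiff_of_mem_higherBrackets L.bchRemainder_mem)

theorem bch_neg (x : E) : L.bch x (-x) = 0 := by
  rw [bch_eq, apply_neg_of_mem_higherBrackets L.bchRemainder_mem, add_neg_cancel, add_zero]

theorem dil_bch (t : ℝ) (x y : E) : L.dil t (L.bch x y) = L.bch (L.dil t x) (L.dil t y) := by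
  rw [L.bch_eq x y, L.bch_eq (L.dil t x), ← dil_of_mem_higherBrackets L.bchRemainder_mem]
  simp only [← dilCLM_apply, map_add]

/-! #### The homogeneous norm -/

/-- The homogeneous norm with unit ball `{x | ∀ i, ‖π i x‖ ≤ ε}`. -/
noncomputable def gauge (ε : ℝ≥0) (x : E) : ℝ≥0 :=
  (Finset.Icc 1 L.step).sup fun i => (‖L.π i x‖₊ / ε) ^ ((i : ℝ)⁻¹)

/-- Trades the roots in the homogeneous norm for polynomial bounds, one for each layer. -/
theorem gauge_le_iff {ε : ℝ≥0} (hε : 0 < ε) {x : E} {t : ℝ≥0} :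
    L.gauge ε x ≤ t ↔ ∀ i ∈ Finset.Icc 1 L.step, ‖L.π i x‖ ≤ ε * t ^ i := by
  refine Finset.sup_le_iff.trans (forall₂_congr fun i hi => ?_)
  have hi0 : (0 : ℝ) < i := by
    have := (Finset.mem_Icc.mp hi).1
    exact_mod_cast this
  rw [NNReal.rpow_inv_le_iff hi0, NNReal.rpow_natCast, div_le_iff₀ hε, mul_comm, ← NNReal.coe_le_coe]
  simp

theorem norm_π_le_gauge {ε : ℝ≥0} (hε : 0 < ε) {x : E} {i : ℕ} (hi : i ∈ Finset.Icc 1 L.step) :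
    ‖L.π i x‖ ≤ ε * L.gauge ε x ^ i :=
  (L.gauge_le_iff hε).mp le_rfl i hi

theorem norm_le_gauge {ε : ℝ≥0} (hε : 0 < ε) {x : E} (h : L.gauge ε x ≤ 1) :
    ‖x‖ ≤ L.step * (ε * L.gauge ε x) := by
  calc ‖x‖ = ‖∑ i ∈ Finset.Icc 1 L.step, L.π i x‖ := by rw [L.sum_π]
    _ ≤ ∑ i ∈ Finset.Icc 1 L.step, ‖L.π i x‖ := norm_sum_le _ _
    _ ≤ ∑ i ∈ Finset.Icc 1 L.step, (ε * L.gauge ε x : ℝ) := by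
      refine Finset.sum_le_sum fun i hi => (L.norm_π_le_gauge hε hi).trans ?_
      gcongr
      exact pow_le_of_le_one (NNReal.coe_nonneg _) (by exact_mod_cast h)
        (by simp only [Finset.mem_Icc] at hi; omega)
    _ = L.step * (ε * L.gauge ε x) := by simp

theorem gauge_neg (ε : ℝ≥0) (x : E) : L.gauge ε (-x) = L.gauge ε x := by
  simp [gauge]

theorem gauge_zero (ε : ℝ≥0) : L.gauge ε (0 : E) = 0 := by
  refine le_antisymm (Finset.sup_le fun i hi => ?_) zero_le
  have hi0 : i ≠ 0 := by simp only [Finset.mem_Icc] at hi; omega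
  rw [map_zero, nnnorm_zero, zero_div, NNReal.zero_rpow (by simpa using hi0)]

theorem eq_zero_of_gauge_eq_zero {ε : ℝ≥0} (hε : 0 < ε) {x : E} (h : L.gauge ε x = 0) : x = 0 := by
  have := L.norm_le_gauge hε (x := x) (by rw [h]; exact zero_le_one)
  rw [h] at this
  simpa using this

theorem gauge_dil (ε : ℝ≥0) (t : ℝ) (x : E) : L.gauge ε (L.dil t x) = ‖t‖₊ * L.gauge ε x := by
  rw [gauge, gauge, NNReal.mul_finset_sup]
  refine Finset.sup_congr rfl fun i hi => ?_
  have hi0 : i ≠ 0 := by simp only [Finset.mem_Icc] at hi; omega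
  rw [L.π_dil, nnnorm_smul, nnnorm_pow, mul_div_assoc, NNReal.mul_rpow,
    NNReal.pow_rpow_inv_natCast _ hi0]

theorem continuous_gauge (ε : ℝ≥0) : Continuous (L.gauge ε) := by
  refine Continuous.finset_sup_apply fun i _ => ?_
  exact (NNReal.continuous_rpow_const (by positivity)).comp
    ((L.π i).continuous.nnnorm.div_const ε)

/-- For small `ε`, the homogeneous norm is subadditive. -/
theorem exists_gauge_bch_le :
    ∃ ε : ℝ≥0, 0 < ε ∧ ∀ x y : E, L.gauge ε (L.bch x y) ≤ L.gauge ε x + L.gauge ε y := by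
  obtain ⟨K, hK, hR⟩ := exists_norm_le_of_mem_higherBrackets L.bchRemainder_mem
  set B : ℝ := ∑ i ∈ Finset.Icc 1 L.step, ‖L.π i‖
  have hB : 0 ≤ B := Finset.sum_nonneg fun i _ => norm_nonneg _
  -- With `ε = 1 / D`, the summand `step` puts `x` and `y` in the unit ball, where the remainder
  -- estimate holds; the last summand absorbs its constant, and the `1` keeps `D` positive.
  set D : ℝ := 1 + L.step + B * K * (L.step : ℝ) ^ 2
  have hDpos : 0 < D := by positivity
  refine ⟨⟨D⁻¹, by positivity⟩, by exact_mod_cast inv_pos.mpr hDpos, ?_⟩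
  set ε : ℝ≥0 := ⟨D⁻¹, by positivity⟩
  have hε : 0 < ε := by exact_mod_cast inv_pos.mpr hDpos
  have hεD : (ε : ℝ) * D = 1 := inv_mul_cancel₀ hDpos.ne'
  have hε' : (0 : ℝ) < ε := by exact_mod_cast hε
  have hε1 : L.step * (ε : ℝ) ≤ 1 := by
    rw [← hεD, mul_comm]
    gcongr
    have : 0 ≤ B * K * (L.step : ℝ) ^ 2 := by positivity
    linarith
  have hε2 : B * K * (L.step : ℝ) ^ 2 * ε ≤ 1 := by
    rw [← hεD, mul_comm]
    gcongr
    have : (0 : ℝ) ≤ L.step := by positivity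
    linarith
  -- By homogeneity it is enough to treat norms `p`, `q` with `p + q = 1`.
  have hunit : ∀ x y : E, L.gauge ε x + L.gauge ε y = 1 → L.gauge ε (L.bch x y) ≤ 1 := by
    intro x y hxy
    have hpq : (L.gauge ε x : ℝ) + L.gauge ε y = 1 := by exact_mod_cast hxy
    have hp1 : L.gauge ε x ≤ 1 := hxy ▸ le_self_add
    have hq1 : L.gauge ε y ≤ 1 := hxy ▸ le_add_self
    have hx := L.norm_le_gauge hε hp1
    have hy := L.norm_le_gauge hε hq1
    rw [L.gauge_le_iff hε]
    intro i hi
    have hxi := L.norm_π_le_gauge hε (x := x) hi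
    have hyi := L.norm_π_le_gauge hε (x := y) hi
    set p : ℝ := (L.gauge ε x : ℝ)
    set q : ℝ := (L.gauge ε y : ℝ)
    have hp : 0 ≤ p := NNReal.coe_nonneg _
    have hq : 0 ≤ q := NNReal.coe_nonneg _
    rw [NNReal.coe_one, one_pow, mul_one, L.bch_eq, map_add, map_add]
    -- The first layer is additive and leaves no room for a remainder. In the others, `p ^ i + q ^ i
    -- ≤ p² + q²` leaves the slack `2pq`, and the remainder takes only `pq`.
    rcases eq_or_ne i 1 with rfl | hi1
    · rw [π_one_of_mem_higherBrackets L.bchRemainder_mem, add_zero]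
      rw [pow_one] at hxi hyi
      calc ‖L.π 1 x + L.π 1 y‖ ≤ ε * p + ε * q := norm_add_le_of_le hxi hyi
        _ = ε := by rw [← mul_add, hpq, mul_one]
    · have hi2 : 2 ≤ i := by simp only [Finset.mem_Icc] at hi; omega
      have hx1 : ‖x‖ ≤ 1 := hx.trans (by
        rw [← mul_assoc]
        exact mul_le_one₀ hε1 hp (by linarith))
      have hy1 : ‖y‖ ≤ 1 := hy.trans (by
        rw [← mul_assoc]
        exact mul_le_one₀ hε1 hq (by linarith))
      have hBi : ‖L.π i‖ ≤ B :=
        Finset.single_le_sum (f := fun i => ‖L.π i‖) (fun _ _ => norm_nonneg _) hi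
      have hRi : ‖L.π i (L.bchRemainder x y)‖ ≤ ε * (p * q) :=
        calc _ ≤ ‖L.π i‖ * ‖L.bchRemainder x y‖ := (L.π i).le_opNorm _
          _ ≤ B * (K * ((L.step * (ε * p)) * (L.step * (ε * q)))) := by
            gcongr
            refine (hR x y hx1 hy1).trans ?_
            gcongr
          _ = (B * K * (L.step : ℝ) ^ 2 * ε) * (ε * (p * q)) := by ring
          _ ≤ 1 * (ε * (p * q)) := by gcongr
          _ = ε * (p * q) := one_mul _
      have hxi2 : ‖L.π i x‖ ≤ ε * p ^ 2 := hxi.trans (by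
        gcongr ε * ?_
        exact pow_le_pow_of_le_one hp (by linarith) hi2)
      have hyi2 : ‖L.π i y‖ ≤ ε * q ^ 2 := hyi.trans (by
        gcongr ε * ?_
        exact pow_le_pow_of_le_one hq (by linarith) hi2)
      refine (norm_add₃_le).trans ((add_le_add (add_le_add hxi2 hyi2) hRi).trans ?_)
      have h1 : p ^ 2 + q ^ 2 + p * q ≤ 1 := by
        have : (p + q) ^ 2 = 1 := by rw [hpq, one_pow]
        nlinarith [mul_nonneg hp hq]
      have h2 := mul_le_mul_of_nonneg_left h1 hε'.le
      linarith
  intro x y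
  rcases eq_or_ne (L.gauge ε x + L.gauge ε y) 0 with h0 | h0
  · obtain ⟨hx, hy⟩ := add_eq_zero.mp h0
    have hx' := L.eq_zero_of_gauge_eq_zero hε hx
    have hy' := L.eq_zero_of_gauge_eq_zero hε hy
    have h00 : L.bch (0 : E) 0 = 0 := by simpa using L.bch_neg 0
    rw [hx', hy', h00, L.gauge_zero]
    exact zero_le
  · set r := L.gauge ε x + L.gauge ε y with hr
    have hn : ‖(r⁻¹ : ℝ)‖₊ = r⁻¹ := by
      rw [nnnorm_inv]
      simp
    have h1 := hunit (L.dil (r : ℝ)⁻¹ x) (L.dil (r : ℝ)⁻¹ y) (by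
      rw [L.gauge_dil, L.gauge_dil, hn, ← mul_add, ← hr, inv_mul_cancel₀ h0])
    rwa [← L.dil_bch, L.gauge_dil, hn, inv_mul_le_iff₀ (pos_iff_ne_zero.mpr h0), mul_one] at h1

end GradedBanachLieAlgebra

/-! ### Banach homogeneous groups -/

namespace GradedBanachLieAlgebra

open Filter Topology
open scoped NNReal

variable {E : Type v} [NormedAddCommGroup E] [NormedSpace ℝ E] {L : GradedBanachLieAlgebra E}
  {G : Type w} [Group G] [TopologicalSpace G] {φ : E ≃ₜ G}

theorem map_zero_of_map_bch (hφ : ∀ x y, φ (L.bch x y) = φ x * φ y) : φ 0 = 1 := by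
  have h := hφ 0 0
  have h00 : L.bch (0 : E) 0 = 0 := by simpa using L.bch_neg 0
  rwa [h00, left_eq_mul] at h

theorem map_neg_of_map_bch (hφ : ∀ x y, φ (L.bch x y) = φ x * φ y) (x : E) :
    φ (-x) = (φ x)⁻¹ := by
  rw [eq_inv_iff_mul_eq_one, ← map_zero_of_map_bch hφ, ← hφ]
  congr 1
  simpa using L.bch_neg (-x)

theorem symm_one_of_map_bch (hφ : ∀ x y, φ (L.bch x y) = φ x * φ y) : φ.symm 1 = 0 := by
  rw [← map_zero_of_map_bch hφ, φ.symm_apply_apply]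

theorem symm_mul_of_map_bch (hφ : ∀ x y, φ (L.bch x y) = φ x * φ y) (g h : G) :
    φ.symm (g * h) = L.bch (φ.symm g) (φ.symm h) := by
  rw [φ.symm_apply_eq, hφ, φ.apply_symm_apply, φ.apply_symm_apply]

theorem symm_inv_of_map_bch (hφ : ∀ x y, φ (L.bch x y) = φ x * φ y) (g : G) :
    φ.symm g⁻¹ = -φ.symm g := by
  rw [φ.symm_apply_eq, map_neg_of_map_bch hφ, φ.apply_symm_apply]

theorem isTopologicalGroup_of_map_bch (hφ : ∀ x y, φ (L.bch x y) = φ x * φ y) :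
    IsTopologicalGroup G where
  continuous_mul := by
    have h : Continuous fun q : G × G => (φ.symm q.1, φ.symm q.2) :=
      (φ.symm.continuous.comp continuous_fst).prodMk (φ.symm.continuous.comp continuous_snd)
    refine (φ.continuous.comp (L.contDiff_bch.continuous.comp h)).congr fun q => ?_
    rw [Function.comp_apply, Function.comp_apply, hφ, φ.apply_symm_apply, φ.apply_symm_apply]
  continuous_inv := by
    have h : Continuous fun g : G => φ (-φ.symm g) := φ.continuous.comp φ.symm.continuous.neg
    refine h.congr fun g => ?_
    rw [map_neg_of_map_bch hφ, φ.apply_symm_apply]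

theorem isScalableGroup_of_map_bch (hφ : ∀ x y, φ (L.bch x y) = φ x * φ y) {δ : ℝ → G → G}
    (hδ : ∀ t x, φ (L.dil t x) = δ t (φ x)) : IsScalableGroup G δ := by
  have hδ' : ∀ t g, δ t g = φ (L.dil t (φ.symm g)) := fun t g => by
    rw [hδ, φ.apply_symm_apply]
  refine ⟨isTopologicalGroup_of_map_bch hφ, ?_, fun t _ p q => ?_, fun t ht => ?_,
    fun s t p => ?_, fun p => ?_⟩
  · simp only [hδ']
    exact φ.continuous.comp (L.continuous_dil.comp
      (continuous_fst.prodMk (φ.symm.continuous.comp continuous_snd)))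
  · rw [hδ', hδ', hδ', symm_mul_of_map_bch hφ, L.dil_bch, hφ]
  · refine Function.bijective_iff_has_inverse.mpr ⟨δ t⁻¹, fun p => ?_, fun p => ?_⟩
    · simp [hδ', L.dil_dil, ht]
    · simp [hδ', L.dil_dil, ht]
  · simp [hδ', L.dil_dil]
  · rw [hδ', L.dil_zero_left, map_zero_of_map_bch hφ]

/-- Translations reduce this to neighbourhoods of `1`. There the homogeneous norm controls the norm
by `norm_le_gauge`, and conversely it is continuous and vanishes at `0`. -/
theorem isOpen_iff_gauge_of_map_bch (hφ : ∀ x y, φ (L.bch x y) = φ x * φ y) {ε : ℝ≥0}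
    (hε : 0 < ε) (s : Set G) : IsOpen s ↔
      ∀ g ∈ s, ∃ r > 0, ∀ h, (L.gauge ε (φ.symm (g⁻¹ * h)) : ℝ) < r → h ∈ s := by
  have := isTopologicalGroup_of_map_bch hφ
  constructor
  · intro hs g hg
    have hopen : IsOpen ((fun x : E => g * φ x) ⁻¹' s) :=
      hs.preimage (φ.continuous.const_mul g)
    obtain ⟨η, hη, hball⟩ := Metric.isOpen_iff.mp hopen 0 (by
      simpa [map_zero_of_map_bch hφ] using hg)
    have hc : 0 < L.step * (ε : ℝ) + 1 := by positivity
    -- The `1` keeps the homogeneous norm in the range of `norm_le_gauge`; the `+ 1` in the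
    -- denominator keeps it positive when `step = 0`.
    refine ⟨min 1 (η / (L.step * (ε : ℝ) + 1)), by positivity, fun h hh => ?_⟩
    obtain ⟨h1, h2⟩ := lt_min_iff.mp hh
    have h3 : φ.symm (g⁻¹ * h) ∈ Metric.ball (0 : E) η := by
      rw [mem_ball_zero_iff]
      refine (L.norm_le_gauge hε (by exact_mod_cast h1.le)).trans_lt ?_
      rw [lt_div_iff₀ hc] at h2
      have : (0 : ℝ) ≤ L.gauge ε (φ.symm (g⁻¹ * h)) := NNReal.coe_nonneg _
      nlinarith
    simpa using hball h3
  · intro h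
    refine isOpen_iff_mem_nhds.mpr fun g hg => ?_
    obtain ⟨r, hr, hsub⟩ := h g hg
    have hcont : Continuous fun h : G => (L.gauge ε (φ.symm (g⁻¹ * h)) : ℝ) :=
      NNReal.continuous_coe.comp ((L.continuous_gauge ε).comp
        (φ.symm.continuous.comp (continuous_const_mul g⁻¹)))
    refine mem_of_superset (hcont.continuousAt.eventually_lt continuousAt_const ?_) hsub
    rw [inv_mul_cancel, symm_one_of_map_bch hφ, L.gauge_zero]
    exact hr

end GradedBanachLieAlgebra

open GradedBanachLieAlgebra in
/-- A Banach homogeneous group has a homogeneous left-invariant distance that induces its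
topology. -/
theorem IsBanachHomogeneousGroup.exists_metricSpace {G : Type w} [Group G]
    [tG : TopologicalSpace G] {δ : ℝ → G → G} (h : IsBanachHomogeneousGroup.{w, v} G δ) :
    ∃ m : MetricSpace G, m.toUniformSpace.toTopologicalSpace = tG ∧
      IsMetricScalableGroup G δ := by
  obtain ⟨E, _, _, _, L, φ, hφ, hδ⟩ := h
  obtain ⟨ε, hε, htri⟩ := L.exists_gauge_bch_le
  let d : G → G → ℝ := fun g h => L.gauge ε (φ.symm (g⁻¹ * h))
  have hscal := isScalableGroup_of_map_bch hφ hδ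
  -- `MetricSpace.ofDistTopology` keeps the given topology definitionally, hence the `rfl` below.
  let m : MetricSpace G := MetricSpace.ofDistTopology d
    (fun g => by simp [d, symm_one_of_map_bch hφ, L.gauge_zero])
    (fun g h => by
      simp only [d]
      rw [← L.gauge_neg, ← symm_inv_of_map_bch hφ, mul_inv_rev, inv_inv])
    (fun g h k => by
      have h1 := htri (φ.symm (g⁻¹ * h)) (φ.symm (h⁻¹ * k))
      rw [← symm_mul_of_map_bch hφ, mul_assoc, mul_inv_cancel_left] at h1
      exact_mod_cast h1)
    (isOpen_iff_gauge_of_map_bch hφ hε)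
    (fun g h hgh => by
      have h1 := L.eq_zero_of_gauge_eq_zero hε (NNReal.coe_eq_zero.mp hgh)
      rw [φ.symm_apply_eq, map_zero_of_map_bch hφ, inv_mul_eq_one] at h1
      exact h1)
  refine ⟨m, rfl, ⟨hscal, fun g p q => ?_, fun t p q => ?_⟩⟩
  · change d (g * p) (g * q) = d p q
    simp only [d]
    congr 3
    group
  · change d (δ t p) (δ t q) = |t| * d p q
    simp only [d]
    rw [← Real.norm_eq_abs, ← coe_nnnorm, ← NNReal.coe_mul, ← L.gauge_dil, symm_mul_of_map_bch hφ,
      symm_mul_of_map_bch hφ, L.dil_bch, symm_inv_of_map_bch hφ, symm_inv_of_map_bch hφ]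
    have h1 : ∀ g, φ.symm (δ t g) = L.dil t (φ.symm g) := fun g => by
      rw [φ.symm_apply_eq, hδ, φ.apply_symm_apply]
    rw [h1, h1, ← L.dilCLM_apply t (-φ.symm p), map_neg, L.dilCLM_apply]

/-- The inverse of `φ` is a global chart in which multiplication is `L.bch`, which is `C¹` and so
strictly differentiable. -/
theorem Ell1.not_isBanachHomogeneousGroup [MetricSpace Heisenberg]
    [IsIsometricSMul Heisenberg Heisenberg] (hd : Heisenberg.IsHomogeneousDist)
    (δ : ℝ → Ell1 Heisenberg → Ell1 Heisenberg) :
    ¬ IsBanachHomogeneousGroup.{0, v} (Ell1 Heisenberg) δ := by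
  rintro ⟨E, _, _, _, L, φ, hφ, -⟩
  have h := (L.contDiff_bch.contDiffAt (x := (φ.symm 1, φ.symm 1))).hasStrictFDerivAt one_ne_zero
  refine Ell1.not_hasStrictFDerivAt_chart_mul hd φ.symm.toOpenPartialHomeomorph trivial _
    (h.congr_of_eventuallyEq (Filter.Eventually.of_forall fun v => ?_))
  change L.bch v.1 v.2 = φ.symm (φ v.1 * φ v.2)
  rw [← hφ, φ.symm_apply_apply]

theorem proposition5p6
    -- an arbitrary homogeneous distance on the first Heisenberg group: left-invariant, inducing the
    -- Lie group topology, and scaled by the dilations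
    [MetricSpace Heisenberg] [IsIsometricSMul Heisenberg Heisenberg]
    (hadm : IsHomeomorph Heisenberg.coords)
    (hhom : ∀ (t : ℝ) (p q : Heisenberg),
      dist (Heisenberg.dil t p) (Heisenberg.dil t q) = |t| * dist p q) :
    -- `ℓ₁(ℍ¹)` is a metric scalable group with the componentwise dilations
    (∃ δ : ℝ → Ell1 Heisenberg → Ell1 Heisenberg,
      (∀ t x n, δ t x n = Heisenberg.dil t (x n)) ∧
      IsMetricScalableGroup (Ell1 Heisenberg) δ) ∧
    -- it is not a Banach Lie group
    (∀ k : WithTop ℕ∞, 1 ≤ k → ¬ IsBanachLieGroup.{0, v} k (Ell1 Heisenberg)) ∧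
    -- its center is `ℓ₁(Z)`, `Z` being the center of `ℍ¹`, and this is `ℓ_{1/2}(ℝ)`
    (∀ x : Ell1 Heisenberg, x ∈ Subgroup.center (Ell1 Heisenberg) ↔
      ∀ n, x n ∈ Subgroup.center Heisenberg) ∧
    (∃ (φ : Multiplicative EllHalf ≃ₜ* Subgroup.center (Ell1 Heisenberg)) (c : ℝ), 0 < c ∧
      (∀ (a : EllHalf) (n : ℕ), (φ (Multiplicative.ofAdd a) : Ell1 Heisenberg) n = ⟨0, 0, a n⟩) ∧
      ∀ a b : EllHalf,
        dist (φ (Multiplicative.ofAdd a)) (φ (Multiplicative.ofAdd b)) = c * dist a b) ∧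
    -- `ℓ_{1/2}(ℝ)` is a topological vector space that is not locally convex
    (IsTopologicalAddGroup EllHalf ∧ ContinuousSMul ℝ EllHalf ∧ ¬ LocallyConvexSpace ℝ EllHalf) ∧
    -- every Banach homogeneous group is a metric scalable group for some admissible distance,
    -- but `ℓ₁(ℍ¹)` is not a Banach homogeneous group, whatever the dilations
    (∀ (G : Type w) [Group G] [tG : TopologicalSpace G] (δ : ℝ → G → G),
      IsBanachHomogeneousGroup.{w, v} G δ →
      ∃ m : MetricSpace G, m.toUniformSpace.toTopologicalSpace = tG ∧
        IsMetricScalableGroup G δ) ∧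
    (∀ δ : ℝ → Ell1 Heisenberg → Ell1 Heisenberg,
      ¬ IsBanachHomogeneousGroup.{0, v} (Ell1 Heisenberg) δ) := by
  have hd : Heisenberg.IsHomogeneousDist := ⟨hadm, hhom⟩
  refine ⟨⟨Ell1.dil hd, fun _ _ _ => rfl, Ell1.isMetricScalableGroup hd⟩,
    fun k hk => Ell1.not_isBanachLieGroup hd hk, fun x => Ell1.mem_center_iff,
    ⟨Ell1.ellHalfEquivCenter hd, dist (Heisenberg.central 1) 1,
      Heisenberg.IsHomogeneousDist.dist_central_pos, fun _ _ => rfl,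
      fun a b => Ell1.dist_ofEllHalf hd a b⟩,
    ⟨EllHalf.isTopologicalAddGroup, EllHalf.continuousSMul, EllHalf.not_locallyConvexSpace⟩,
    fun G _ _ δ h => h.exists_metricSpace, Ell1.not_isBanachHomogeneousGroup hd⟩
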